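/- Let $(X,\mathcal B)$ be a measurable space with countably generated $\sigma$-field. A random walk on $X$ is a family $m=(m_x)_{x\in X}$ of probability measures on $\mathcal B$ such that $x\mapsto m_x(B)$ is measurable for every $B\in\mathcal B$. A $\sigma$-finite measure $\nu$ is invariant for $m$ if $\nu(B)=\int_X m_x(B)\,d\nu(x)$ for all $B\in\mathcal B$, and reversible for $m$ if $\int_A m_x(B)\,d\nu(x)=\int_B m_x(A)\,d\nu(x)$ for all $A,B\in\mathcal B$ (reversible measures are invariant). Let $\nu\otimes m_x$ be the measure on $X\times X$ with $(\nu\otimes m_x)(A\times B)=\int_A m_x(B)\,d\nu(x)$. Write $\nabla u(x,y)=u(y)-u(x)$ and $\operatorname{div}_m \mathbf z(x)=\frac12\int_X(\mathbf z(x,y)-\mathbf z(y,x))\,dm_x(y)$. Let $m^1,m^2$ be random walks on $X$, let $\nu_1$ be a $\sigma$-finite measure invariant for $m^1$, and let $\nu_2$ be a $\sigma$-finite measure reversible for $m^2$. Assume $\nu_2\ll\nu_1$, $\mu:=\frac{d\nu_2}{d\nu_1}\in L^\infty(X,\nu_1)$, and that there is $c>0$ with $\mu\ge c$ $\nu_1$-a.e.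 Let $1<p<\infty$, and suppose that either (a) $\nu_1(X)<\infty$, or (b) $\nu_1(X)=+\infty$ and $p\ge2$. Let $H=L^2(X,\nu_1)$ and define $\mathcal F_{1,m^1},\mathcal F_{p,m^2}:H\to[0,+\infty]$ by $$\mathcal F_{1,m^1}(u)=\frac12\int_{X\times X}|\nabla u|\,d(\nu_1\otimes m^1_x),\qquad \mathcal F_{p,m^2}(u)=\frac1{2p}\int_{X\times X}|\nabla u|^p\,d(\nu_2\otimes m^2_x),$$ with the value $+\infty$ when the integral is infinite. For a proper functional $\Phi:H\to(-\infty,+\infty]$, $\partial_H\Phi$ is the set of pairs $(u,v)\in H\times H$ such that $\Phi(u)<+\infty$ and $\Phi(w)-\Phi(u)\ge(v,w-u)_H$ for all $w\in H$. The operator $\Delta_1^{m^1}$ on $H$ is defined by $(u,v)\in\Delta_1^{m^1}\iff(u,-v)\in\partial_H\mathcal F_{1,m^1}$. The operator $\Delta_p^{m^2}$ is defined by: $(u,v)\in\Delta_p^{m^2}$ if and only if $u,v\in L^2(X,\nu_2)$, $\nabla u\in L^p(X\times X,\nu_2\otimes m^2_x)$ and $v=\operatorname{div}_{m^2}(|\nabla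 u|^{p-2}\nabla u)$ $\nu_2$-a.e. The operator $-\Delta_1^{m^1}-\mu\Delta_p^{m^2}$ on $H$ consists of the pairs $(u,v)\in H\times H$ for which there are $v_1,v_2$ with $(u,v_1)\in\Delta_1^{m^1}$, $(u,v_2)\in\Delta_p^{m^2}$ and $v=-v_1-\mu v_2$. Then $$\partial_H\big(\mathcal F_{1,m^1}+\mathcal F_{p,m^2}\big)=-\Delta_1^{m^1}-\mu\,\Delta_p^{m^2}.$$ Moreover, this operator has dense domain in $H$, where the domain of $A\subset H\times H$ is $\{u:\ (u,v)\in A\text{ for some }v\}$. It is also completely accretive: for all $\lambda>0$, all pairs $(u_1,v_1),(u_2,v_2)$ in it, and every convex lower semicontinuous $j:\mathbb R\to[0,+\infty]$ with $j(0)=0$, $$\int_X j(u_1-u_2)\,d\nu_1\le\int_X j\big(u_1-u_2+\lambda(v_1-v_2)\big)\,d\nu_1.$$ -/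

import Mathlib

open MeasureTheory ProbabilityTheory
open scoped ENNReal NNReal

noncomputable section

namespace RandomWalk

/-- The subdifferential of a functional `Φ : E → (-∞, +∞]`, as a multivalued operator (a set of
pairs): `(u, v)` belongs to it iff `Φ u < +∞` and `Φ w - Φ u ≥ ⟪v, w - u⟫` for all `w`. For a proper
`Φ` the condition `Φ u < +∞` follows from the inequality. -/
def subdifferential {E : Type*} [NormedAddCommGroup E] [InnerProductSpace ℝ E]
    (Φ : E → EReal) : Set (E × E) :=
  {q | Φ q.1 ≠ ⊤ ∧ ∀ w : E, Φ q.1 + ((inner ℝ q.2 (w - q.1) : ℝ) : EReal) ≤ Φ w}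

/-- The domain of a multivalued operator, given by its graph. -/
def operatorDomain {E : Type*} (A : Set (E × E)) : Set E :=
  {u | ∃ v, (u, v) ∈ A}

variable {X : Type*} [MeasurableSpace X]

/-- The relation `u ≪ v`: `∫ j(u) dν ≤ ∫ j(v) dν` for every convex, lower semicontinuous
`j : ℝ → [0, +∞]` with `j 0 = 0`. -/
def CompletelyDominated (ν : Measure X) (u v : X → ℝ) : Prop :=
  ∀ j : ℝ → ℝ≥0∞, ConvexOn ℝ≥0 Set.univ j → LowerSemicontinuous j → j 0 = 0 →
    ∫⁻ x, j (u x) ∂ν ≤ ∫⁻ x, j (v x) ∂ν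

/-- Complete accretivity of an operator on `L²(X, ν)`, given by its graph. -/
def IsCompletelyAccretive {ν : Measure X} (A : Set (Lp ℝ 2 ν × Lp ℝ 2 ν)) : Prop :=
  ∀ r : ℝ, 0 < r → ∀ q₁ ∈ A, ∀ q₂ ∈ A,
    CompletelyDominated ν (q₁.1 - q₂.1 : Lp ℝ 2 ν) (q₁.1 - q₂.1 + r • (q₁.2 - q₂.2) : Lp ℝ 2 ν)

/-- The nonlocal gradient `∇u(x, y) = u(y) - u(x)`. -/
def nonlocalGrad (u : X → ℝ) : X × X → ℝ :=
  fun z => u z.2 - u z.1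

/-- The `m`-divergence of `z : X × X → ℝ`. -/
def nonlocalDiv (m : Kernel X X) (z : X × X → ℝ) : X → ℝ :=
  fun x => (1 / 2) * ∫ y, (z (x, y) - z (y, x)) ∂(m x)

/-- The functional `𝓕_{1,m}`: half of `∫ |u(y) - u(x)| d(ν ⊗ m_x)(x, y)`, equal to `+∞` when the
integral is infinite, that is, when `u` is not in `BV_m(X, ν)`. -/
def totalVariation (m : Kernel X X) (ν : Measure X) (u : X → ℝ) : ℝ≥0∞ :=
  ENNReal.ofReal (1 / 2) * ∫⁻ z, ENNReal.ofReal |nonlocalGrad u z| ∂(ν.compProd m)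

/-- The functional `𝓕_{p,m}`: `1/(2p)` times `∫ |u(y) - u(x)|^p d(ν ⊗ m_x)(x, y)`, equal to `+∞`
when the integral is infinite, that is, when `∇u` is not in `L^p(X × X, ν ⊗ m_x)`. -/
def pEnergy (p : ℝ) (m : Kernel X X) (ν : Measure X) (u : X → ℝ) : ℝ≥0∞ :=
  ENNReal.ofReal (1 / (2 * p)) *
    ∫⁻ z, ENNReal.ofReal (|nonlocalGrad u z| ^ p) ∂(ν.compProd m)

/-- The `m`-`1`-Laplacian `Δ₁^m` in `L²(X, ν)`: `(u, v) ∈ Δ₁^m` iff `(u, -v)` is in the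
subdifferential of `𝓕_{1,m}`. -/
def oneLaplacian (m : Kernel X X) (ν : Measure X) : Set (Lp ℝ 2 ν × Lp ℝ 2 ν) :=
  {q | (q.1, -q.2) ∈
    subdifferential (fun u : Lp ℝ 2 ν => (totalVariation m ν u : EReal))}

/-- The `m`-`p`-Laplacian `Δ_p^m` in `L²(X, ν)`: `(u, v) ∈ Δ_p^m` iff `u, v ∈ L²(X, ν)`,
`∇u ∈ L^p(X × X, ν ⊗ m_x)` and `v = div_m (|∇u|^{p-2} ∇u)`. -/
def pLaplacian (p : ℝ) (m : Kernel X X) (ν : Measure X) : Set (Lp ℝ 2 ν × Lp ℝ 2 ν) :=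
  {q | MemLp (nonlocalGrad q.1) (ENNReal.ofReal p) (ν.compProd m) ∧
    q.2 =ᵐ[ν] nonlocalDiv m
      (fun z => |nonlocalGrad q.1 z| ^ (p - 2) * nonlocalGrad q.1 z)}

/-- The Radon-Nikodym derivative `dν₂/dν₁` as a real-valued function. -/
def density (ν₁ ν₂ : Measure X) : X → ℝ :=
  fun x => (ν₂.rnDeriv ν₁ x).toReal

/-- The multivalued operator `-Δ₁^{m₁} - μ Δ_p^{m₂}` on `H = L²(X, ν₁)`, where `μ = dν₂/dν₁`. Its
value at `u` consists of all `v ∈ H` of the form `v = -v₁ - μ v₂` with `v₁ ∈ Δ₁^{m₁} u` and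
`v₂ ∈ Δ_p^{m₂} u`; the operator `Δ_p^{m₂}` lives in `L²(X, ν₂)`, so that `u` enters it through its
class `u₂` modulo `ν₂`-null sets. -/
def onePLaplacian (p : ℝ) (m₁ m₂ : Kernel X X) (ν₁ ν₂ : Measure X) :
    Set (Lp ℝ 2 ν₁ × Lp ℝ 2 ν₁) :=
  {q | ∃ v₁ : Lp ℝ 2 ν₁, ∃ u₂ v₂ : Lp ℝ 2 ν₂,
    (q.1, v₁) ∈ oneLaplacian m₁ ν₁ ∧ (u₂, v₂) ∈ pLaplacian p m₂ ν₂ ∧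
    u₂ =ᵐ[ν₂] q.1 ∧ q.2 =ᵐ[ν₁] fun x => -v₁ x - density ν₁ ν₂ x * v₂ x}

/-- The functional `𝓕_{1,m₁} + 𝓕_{p,m₂}` on `H = L²(X, ν₁)`. -/
def onePEnergy (p : ℝ) (m₁ m₂ : Kernel X X) (ν₁ ν₂ : Measure X) (u : Lp ℝ 2 ν₁) : EReal :=
  (totalVariation m₁ ν₁ u : EReal) + (pEnergy p m₂ ν₂ u : EReal)

end RandomWalk

end

/-!
# The `(1, p)`-Laplacian on a random walk space

Write `π₁ = ν₁ ⊗ m₁`, `π₂ = ν₂ ⊗ m₂` and `D = ∫ |∇u|^{p-2} ∇u dm₂`, which is the `p`-Laplacian of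
`u` because the flux `|∇u|^{p-2} ∇u` is antisymmetric. When `ν₁` is infinite, neither energy needs
to be continuous on `L²(ν₁)`, which the usual sum rule for subdifferentials requires of one of them.
The inclusion of the subdifferential of the sum in the sum of the operators is obtained directly.

Let `v` be a subgradient of the sum at `u`. Moving from `u` in the direction of a bounded integrable
`w` and letting the step tend to `0`, the `p`-energy is differentiated and the total variation is
kept (`first_variation`), so that `V = v + μ D` satisfies the subgradient inequality of the total
variation for such `w`. The total variation of `w` is at most `‖w‖₁`, hence `|V| ≤ 1`. On the other
hand the flux is in `L¹ + L²`, by splitting it according to whether `|∇u| > 1`; this is where a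
finite measure or `p ≥ 2` is needed (`exists_pFlux_decomposition`). A bounded function in
`L¹ + L²` is in `L²` (`memLp_two_of_bounded_of_add`). So `V ∈ L²`, and then `D ∈ L²`, as `μ` is
bounded from below. A truncation of `w`, under which `|∇w|` does not increase, extends the
subgradient inequality to all `w ∈ L²` (`subgradient_totalVariation_of_bounded`).

The converse inclusion is convexity of `|·|^p` with integration by parts, which rests on the
symmetry of `π₂` and again on the `L¹ + L²` decomposition and truncation
(`integral_pFlux_mul_nonlocalGrad_of_memLp`).

For complete accretivity, exchanging `q(u₁ - u₂)` between `u₁` and `u₂` decreases the sum of the two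
energies when `q` is nondecreasing and `1`-Lipschitz (`gradEnergy_contraction_le`). Hence
`∫ (v₁ - v₂) q(u₁ - u₂) ≥ 0`, and the claim for a general `j` follows by taking for `q` the
derivatives of its Moreau envelopes (`exists_moreau_approximation`,
`completelyDominated_of_integral_nonneg`).

The domain is dense since it contains the simple functions in `L²`: if `u` is bounded and lives on a
set of finite measure, the sign of `∇u` and the flux are in `L²`, so a subgradient of the total
variation is the image of the sign under the adjoint of `∇ : L²(ν₁) → L²(π₁)`, up to the factor
`1/2` (`mem_operatorDomain_of_bounded`).
-/

namespace RandomWalk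

open Filter Topology

/-! ### Truncation and powers on the real line -/

/-- The truncation of `r` at levels `1 / (n + 1)` and `n + 1`: it vanishes for `|r| ≤ 1 / (n + 1)`
and is constant for `r ≥ n + 1` and for `r ≤ -(n + 1)`. -/
noncomputable def truncation (n : ℕ) (r : ℝ) : ℝ :=
  max (min r (n + 1)) (-(n + 1)) - max (min r (1 / (n + 1))) (-(1 / (n + 1)))

lemma one_div_succ_le (n : ℕ) : (1 : ℝ) / (n + 1) ≤ n + 1 := by
  have h : (1 : ℝ) ≤ n + 1 := by linarith [Nat.cast_nonneg (α := ℝ) n]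
  rw [div_le_iff₀ (by linarith)]
  nlinarith

lemma one_div_succ_pos (n : ℕ) : (0 : ℝ) < 1 / (n + 1) := by positivity

lemma continuous_truncation (n : ℕ) : Continuous (truncation n) := by
  unfold truncation; fun_prop

lemma truncation_sub_bounds {n : ℕ} {r s : ℝ} (h : r ≤ s) :
    0 ≤ truncation n s - truncation n r ∧ truncation n s - truncation n r ≤ s - r := by
  have h1 := one_div_succ_le n
  have h0 := one_div_succ_pos n
  unfold truncation
  generalize (1 : ℝ) / (n + 1) = a at *
  generalize (n : ℝ) + 1 = b at *
  grind

lemma truncation_zero (n : ℕ) : truncation n 0 = 0 := by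
  have h1 := one_div_succ_le n
  have h0 := one_div_succ_pos n
  unfold truncation
  generalize (1 : ℝ) / (n + 1) = a at *
  generalize (n : ℝ) + 1 = b at *
  grind

lemma abs_truncation_sub_le (n : ℕ) (r s : ℝ) :
    |truncation n s - truncation n r| ≤ |s - r| := by
  rcases le_total r s with h | h
  · have := truncation_sub_bounds (n := n) h
    rw [abs_of_nonneg this.1, abs_of_nonneg (sub_nonneg.2 h)]
    exact this.2
  · have := truncation_sub_bounds (n := n) h
    rw [abs_sub_comm, abs_sub_comm s, abs_of_nonneg this.1, abs_of_nonneg (sub_nonneg.2 h)]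
    exact this.2

lemma abs_truncation_le (n : ℕ) (r : ℝ) : |truncation n r| ≤ |r| := by
  simpa [truncation_zero] using abs_truncation_sub_le n 0 r

lemma abs_truncation_le_const (n : ℕ) (r : ℝ) : |truncation n r| ≤ n + 1 := by
  have h1 := one_div_succ_le n
  have h0 := one_div_succ_pos n
  unfold truncation
  generalize (1 : ℝ) / (n + 1) = a at *
  generalize (n : ℝ) + 1 = b at *
  rw [abs_le]
  constructor <;> grind

/-- Since the truncation vanishes for `|r| ≤ 1 / (n + 1)`, it maps `L²` to `L¹`. -/
lemma abs_truncation_le_sq (n : ℕ) (r : ℝ) : |truncation n r| ≤ (n + 1) * r ^ 2 := by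
  have h0 := one_div_succ_pos n
  by_cases h : |r| ≤ 1 / (n + 1)
  · have h1 := one_div_succ_le n
    have : truncation n r = 0 := by
      rw [abs_le] at h
      unfold truncation
      generalize (1 : ℝ) / (n + 1) = a at *
      generalize (n : ℝ) + 1 = b at *
      grind
    rw [this, abs_zero]
    positivity
  · push Not at h
    have hb : (0 : ℝ) < n + 1 := by positivity
    rw [div_lt_iff₀ hb] at h
    calc |truncation n r| ≤ |r| * 1 := by simpa using abs_truncation_le n r
      _ ≤ |r| * (|r| * (n + 1)) := by gcongr
      _ = (n + 1) * r ^ 2 := by rw [← sq_abs]; ring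

lemma tendsto_truncation (r : ℝ) : Tendsto (fun n => truncation n r) atTop (𝓝 r) := by
  have h0 : Tendsto (fun n : ℕ => (1 : ℝ) / (n + 1)) atTop (𝓝 0) :=
    tendsto_one_div_add_atTop_nhds_zero_nat
  rw [tendsto_iff_dist_tendsto_zero]
  refine squeeze_zero' (Eventually.of_forall fun _ => dist_nonneg) ?_ h0
  obtain ⟨N, hN⟩ := exists_nat_ge |r|
  filter_upwards [eventually_ge_atTop N] with n hn
  have hn' : (N : ℝ) ≤ n := by exact_mod_cast hn
  have h1 := one_div_succ_le n
  have h0 := one_div_succ_pos n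
  have h2 : |r| ≤ (n : ℝ) + 1 := by linarith
  rw [abs_le] at h2
  unfold truncation
  rw [Real.dist_eq, abs_le]
  generalize (1 : ℝ) / (n + 1) = a at *
  generalize (n : ℝ) + 1 = b at *
  constructor <;> grind

/-- The flux `|r|^{p-2} r`, which is the derivative of `|r|^p / p`. -/
noncomputable def pFlux (p r : ℝ) : ℝ := |r| ^ (p - 2) * r

lemma pFlux_neg (p r : ℝ) : pFlux p (-r) = -pFlux p r := by simp [pFlux]

lemma abs_pFlux {p : ℝ} (hp : 1 < p) (r : ℝ) : |pFlux p r| = |r| ^ (p - 1) := by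
  rcases eq_or_ne r 0 with rfl | h
  · simp [pFlux, Real.zero_rpow (by linarith : p - 1 ≠ 0)]
  · have h' : 0 < |r| := abs_pos.2 h
    rw [pFlux, abs_mul, abs_of_nonneg (Real.rpow_nonneg h'.le _), ← Real.rpow_add_one h'.ne']
    congr 1; ring

lemma continuous_pFlux {p : ℝ} (hp : 1 < p) : Continuous (pFlux p) := by
  rw [continuous_iff_continuousAt]
  intro r
  rcases eq_or_ne r 0 with rfl | h
  · have h0 : pFlux p 0 = 0 := by simp [pFlux]
    rw [ContinuousAt, h0, tendsto_zero_iff_abs_tendsto_zero]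
    have : (abs ∘ pFlux p) = fun r => |r| ^ (p - 1) := funext fun r => abs_pFlux hp r
    rw [this]
    have hc : Continuous fun r : ℝ => |r| ^ (p - 1) :=
      continuous_abs.rpow_const fun _ => Or.inr (by linarith)
    simpa [Real.zero_rpow (by linarith : p - 1 ≠ 0)] using hc.tendsto 0
  · unfold pFlux
    exact (continuous_abs.continuousAt.rpow_const (Or.inl (abs_pos.2 h).ne')).mul continuousAt_id

lemma measurable_pFlux (p : ℝ) : Measurable (pFlux p) := by unfold pFlux; fun_prop

lemma convexOn_abs_rpow {p : ℝ} (hp : 1 ≤ p) : ConvexOn ℝ Set.univ fun r : ℝ => |r| ^ p := by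
  have h1 : ConvexOn ℝ Set.univ fun r : ℝ => |r| := convexOn_norm (E := ℝ) convex_univ
  refine ⟨convex_univ, fun x _ y _ a b ha hb hab => ?_⟩
  have h2 := (convexOn_rpow hp).2 (abs_nonneg x) (abs_nonneg y) ha hb hab
  refine le_trans ?_ h2
  exact Real.rpow_le_rpow (abs_nonneg _) (h1.2 trivial trivial ha hb hab) (by linarith)

lemma abs_rpow_add_pFlux_le {p : ℝ} (hp : 1 < p) (r s : ℝ) :
    |r| ^ p + p * pFlux p r * (s - r) ≤ |s| ^ p := by
  have hd : HasDerivAt (fun x : ℝ => |x| ^ p) (p * pFlux p r) r := by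
    have := hasDerivAt_abs_rpow r hp
    rwa [mul_assoc] at this
  have hc := convexOn_abs_rpow hp.le
  rcases lt_trichotomy r s with h | rfl | h
  · have := hc.le_slope_of_hasDerivAt trivial trivial h hd
    rw [slope_def_field, le_div_iff₀ (sub_pos.2 h)] at this
    linarith
  · simp
  · have := hc.slope_le_of_hasDerivAt trivial trivial h hd
    rw [slope_def_field, div_le_iff₀ (sub_pos.2 h)] at this
    linarith

/-- If `δ` lies between `0` and `a - b`, moving `a` and `b` towards each other by `δ` decreases
`f a + f b`. -/
lemma _root_.ConvexOn.add_le_of_contraction {f : ℝ → ℝ} (hf : ConvexOn ℝ Set.univ f) {a b δ : ℝ}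
    (h : (0 ≤ δ ∧ δ ≤ a - b) ∨ (a - b ≤ δ ∧ δ ≤ 0)) :
    f (a - δ) + f (b + δ) ≤ f a + f b := by
  rcases eq_or_ne a b with rfl | hab
  · have : δ = 0 := by rcases h with h | h <;> linarith [h.1, h.2]
    simp [this]
  have hne : a - b ≠ 0 := sub_ne_zero.2 hab
  have ht : 0 ≤ δ / (a - b) ∧ δ / (a - b) ≤ 1 := by
    rcases h with h | h
    · exact ⟨div_nonneg h.1 (h.1.trans h.2), div_le_one_of_le₀ h.2 (h.1.trans h.2)⟩
    · exact ⟨div_nonneg_of_nonpos h.2 (h.1.trans h.2),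
        (div_le_one_of_neg (lt_of_le_of_ne (h.1.trans h.2) hne)).2 h.1⟩
  obtain ⟨t, rfl⟩ : ∃ t, δ = t * (a - b) := ⟨δ / (a - b), by field_simp⟩
  rw [mul_div_cancel_right₀ _ hne] at ht
  have h1 := hf.2 (x := a) (y := b) trivial trivial (sub_nonneg.2 ht.2) ht.1 (by ring)
  have h2 := hf.2 (x := a) (y := b) trivial trivial ht.1 (sub_nonneg.2 ht.2) (by ring)
  simp only [smul_eq_mul] at h1 h2
  have e1 : a - t * (a - b) = (1 - t) * a + t * b := by ring
  have e2 : b + t * (a - b) = t * a + (1 - t) * b := by ring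
  rw [e1, e2]
  linarith

/-! ### Moreau envelopes of convex functions of one variable -/

/-- The value at `r` of the proximal map of `j` with parameter `k`: `a` minimizes
`s ↦ j s + k / 2 * (r - s) ^ 2`. -/
noncomputable def IsProx (j : ℝ → ℝ≥0∞) (k r a : ℝ) : Prop :=
  ∀ s, j a + ENNReal.ofReal (k / 2 * (r - a) ^ 2) ≤ j s + ENNReal.ofReal (k / 2 * (r - s) ^ 2)

lemma exists_isProx {j : ℝ → ℝ≥0∞} (hj : LowerSemicontinuous j) (h0 : j 0 = 0) {k : ℝ}
    (hk : 0 < k) (r : ℝ) : ∃ a, IsProx j k r a := by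
  have hg : LowerSemicontinuous fun s => j s + ENNReal.ofReal (k / 2 * (r - s) ^ 2) := by
    refine hj.add (Continuous.lowerSemicontinuous ?_)
    exact ENNReal.continuous_ofReal.comp (by fun_prop)
  have hr : (0 : ℝ) ≤ 2 * |r| := by positivity
  obtain ⟨a, -, ha⟩ := (hg.lowerSemicontinuousOn (Set.Icc (-(2 * |r|)) (2 * |r|))).exists_isMinOn
    ⟨0, by constructor <;> linarith⟩ isCompact_Icc
  rw [isMinOn_iff] at ha
  refine ⟨a, fun s => ?_⟩
  by_cases hs : s ∈ Set.Icc (-(2 * |r|)) (2 * |r|)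
  · exact ha s hs
  · refine (ha 0 ⟨by linarith, hr⟩).trans ?_
    rw [h0, zero_add]
    refine le_add_left (ENNReal.ofReal_le_ofReal ?_)
    have hs' : 2 * |r| < |s| := by
      by_contra hc
      exact hs (abs_le.1 (not_lt.1 hc))
    have : |r| ≤ |r - s| := by
      have := abs_sub_abs_le_abs_sub s r
      rw [abs_sub_comm] at this
      linarith
    have := sq_le_sq.2 this
    rw [sub_zero]
    gcongr

lemma IsProx.ne_top {j : ℝ → ℝ≥0∞} (h0 : j 0 = 0) {k r a : ℝ} (h : IsProx j k r a) :
    j a ≠ ∞ := by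
  have := (le_self_add.trans (h 0)).trans_lt
    (by rw [h0, zero_add]; exact ENNReal.ofReal_lt_top)
  exact this.ne

/-- The first order condition of a proximal point: `k * (r - a)` is a subgradient of `j` at `a`. -/
lemma IsProx.subgradient {j : ℝ → ℝ≥0∞} (hc : ConvexOn ℝ≥0 Set.univ j) (h0 : j 0 = 0) {k r a : ℝ}
    (hk : 0 < k) (h : IsProx j k r a) {s : ℝ} (hs : j s ≠ ∞) :
    (j a).toReal + k * (r - a) * (s - a) ≤ (j s).toReal := by
  have ha := h.ne_top h0
  have key : ∀ t : ℝ, 0 < t → t ≤ 1 →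
      (j a).toReal + k * (r - a) * (s - a) ≤ (j s).toReal + k / 2 * t * (s - a) ^ 2 := by
    intro t ht ht1
    obtain ⟨t', rfl⟩ : ∃ t' : ℝ≥0, (t' : ℝ) = t := ⟨⟨t, ht.le⟩, rfl⟩
    obtain ⟨b, hb⟩ : ∃ b : ℝ≥0, (b : ℝ) = 1 - t' := ⟨⟨1 - t', by linarith⟩, rfl⟩
    have hcv := hc.2 (Set.mem_univ a) (Set.mem_univ s) (zero_le (a := b)) (zero_le (a := t'))
      (by ext; simp [hb])
    have hpr := h (b • a + t' • s)
    have hfin : b • j a + t' • j s ≠ ∞ := by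
      simp only [ENNReal.smul_def, smul_eq_mul]
      finiteness
    have hfin' : j (b • a + t' • s) ≠ ∞ := ne_top_of_le_ne_top hfin hcv
    have h1 := ENNReal.toReal_mono hfin hcv
    have h2 := ENNReal.toReal_mono (by finiteness) hpr
    rw [ENNReal.toReal_add ha (by finiteness), ENNReal.toReal_add hfin' (by finiteness),
      ENNReal.toReal_ofReal (by positivity), ENNReal.toReal_ofReal (by positivity)] at h2
    simp only [ENNReal.smul_def, smul_eq_mul] at h1
    rw [ENNReal.toReal_add (by finiteness) (by finiteness), ENNReal.toReal_mul,
      ENNReal.toReal_mul] at h1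
    simp only [ENNReal.coe_toReal, NNReal.smul_def, smul_eq_mul, hb] at h1 h2
    have h3 : t' * ((j a).toReal + k * (r - a) * (s - a)) ≤
        t' * ((j s).toReal + k / 2 * t' * (s - a) ^ 2) := by nlinarith
    exact le_of_mul_le_mul_left h3 ht
  have hlim : Tendsto (fun t : ℝ => (j s).toReal + k / 2 * t * (s - a) ^ 2) (𝓝[>] 0)
      (𝓝 ((j s).toReal + k / 2 * 0 * (s - a) ^ 2)) := by
    refine Tendsto.mono_left (Continuous.tendsto ?_ 0) nhdsWithin_le_nhds
    fun_prop
  simp only [mul_zero, zero_mul, add_zero] at hlim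
  refine ge_of_tendsto hlim ?_
  filter_upwards [Ioc_mem_nhdsGT (zero_lt_one' ℝ)] with t ht
  exact key t ht.1 ht.2

/-- A convex lower semicontinuous `j ≥ 0` with `j 0 = 0` is, up to `liminf`, approximated from
below by functions `J n` with Lipschitz nondecreasing subgradients `Q n`: its Moreau envelopes. -/
lemma exists_moreau_approximation {j : ℝ → ℝ≥0∞} (hc : ConvexOn ℝ≥0 Set.univ j)
    (hj : LowerSemicontinuous j) (h0 : j 0 = 0) :
    ∃ J Q : ℕ → ℝ → ℝ, (∀ n, Measurable (J n)) ∧ (∀ n r, 0 ≤ J n r) ∧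
      (∀ n r, J n r ≤ (n + 1) * r ^ 2) ∧
      (∀ n r, ENNReal.ofReal (J n r) ≤ j r) ∧
      (∀ r, j r ≤ liminf (fun n => ENNReal.ofReal (J n r)) atTop) ∧
      (∀ n, Q n 0 = 0) ∧
      (∀ n r s, r ≤ s → 0 ≤ Q n s - Q n r ∧ Q n s - Q n r ≤ (n + 1) * (s - r)) ∧
      ∀ n r s, J n r + Q n r * (s - r) ≤ J n s := by
  have hk : ∀ n : ℕ, (0 : ℝ) < n + 1 := fun n => by positivity
  choose a ha using fun (n : ℕ) (r : ℝ) => exists_isProx hj h0 (hk n) r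
  have hfin : ∀ n r, j (a n r) ≠ ∞ := fun n r => (ha n r).ne_top h0
  have hsub : ∀ n r s, j s ≠ ∞ →
      (j (a n r)).toReal + (n + 1) * (r - a n r) * (s - a n r) ≤ (j s).toReal :=
    fun n r s hs => (ha n r).subgradient hc h0 (hk n) hs
  have ha0 : ∀ n, a n 0 = 0 := by
    intro n
    have h1 := hsub n 0 0 (by simp [h0])
    have h2 : 0 ≤ (j (a n 0)).toReal := ENNReal.toReal_nonneg
    rw [h0, ENNReal.toReal_zero] at h1
    have h3 : (n + 1 : ℝ) * (a n 0) ^ 2 ≤ 0 := by nlinarith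
    have h4 : (a n 0) ^ 2 ≤ 0 := by
      by_contra hcon
      push Not at hcon
      linarith [mul_pos (hk n) hcon]
    nlinarith
  have hmono : ∀ n r s, r ≤ s → 0 ≤ a n s - a n r ∧ a n s - a n r ≤ s - r := by
    intro n r s hrs
    have h1 := hsub n r (a n s) (hfin n s)
    have h2 := hsub n s (a n r) (hfin n r)
    have h3 : 0 ≤ (n + 1 : ℝ) * ((s - r - (a n s - a n r)) * (a n s - a n r)) := by nlinarith
    have h4 : 0 ≤ (s - r - (a n s - a n r)) * (a n s - a n r) :=
      nonneg_of_mul_nonneg_right h3 (hk n)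
    constructor
    · by_contra hcon
      push Not at hcon
      nlinarith
    · by_contra hcon
      push Not at hcon
      nlinarith
  have hcont : ∀ n, Measurable (a n) := fun n =>
    (show Monotone (a n) from fun r s h => by linarith [(hmono n r s h).1]).measurable
  have hJ : ∀ n r, ENNReal.ofReal ((j (a n r)).toReal + (n + 1) / 2 * (r - a n r) ^ 2) =
      j (a n r) + ENNReal.ofReal ((n + 1) / 2 * (r - a n r) ^ 2) := by
    intro n r
    rw [ENNReal.ofReal_add ENNReal.toReal_nonneg (by positivity), ENNReal.ofReal_toReal (hfin n r)]
  refine ⟨fun n r => (j (a n r)).toReal + (n + 1) / 2 * (r - a n r) ^ 2,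
    fun n r => (n + 1) * (r - a n r), ?_, ?_, ?_, ?_, ?_, ?_, ?_, ?_⟩
  · intro n
    have := hcont n
    have := hj.measurable.comp (hcont n)
    exact (ENNReal.measurable_toReal.comp this).add (by fun_prop)
  · intro n r
    positivity
  · intro n r
    have h1 := hsub n r 0 (by simp [h0])
    rw [h0, ENNReal.toReal_zero] at h1
    have : 0 ≤ (n + 1 : ℝ) * (r ^ 2 + (a n r) ^ 2) := by positivity
    dsimp only
    nlinarith
  · intro n r
    rw [hJ]
    simpa using ha n r r
  · intro r
    refine le_of_forall_lt fun c hcr => ?_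
    obtain ⟨d, hcd, hdr⟩ := exists_between hcr
    refine hcd.trans_le (le_liminf_of_le (by isBoundedDefault) ?_)
    obtain ⟨δ, hδ, hball⟩ := Metric.eventually_nhds_iff.1 (hj r d hdr)
    obtain ⟨N, hN⟩ := exists_nat_ge (d.toReal / (δ ^ 2 / 2))
    filter_upwards [eventually_ge_atTop N] with n hn
    rw [hJ]
    by_cases hdist : dist (a n r) r < δ
    · exact (hball hdist).le.trans le_self_add
    · refine le_trans ?_ le_add_self
      rw [← ENNReal.ofReal_toReal hdr.ne_top]
      apply ENNReal.ofReal_le_ofReal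
      push Not at hdist
      rw [div_le_iff₀ (by positivity)] at hN
      have hn' : (N : ℝ) ≤ n := by exact_mod_cast hn
      have h2 : δ ^ 2 ≤ (r - a n r) ^ 2 := by
        rw [dist_comm, Real.dist_eq] at hdist
        rw [← sq_abs (r - a n r)]
        gcongr
      calc d.toReal ≤ N * (δ ^ 2 / 2) := hN
        _ ≤ (n + 1) * ((r - a n r) ^ 2 / 2) := by gcongr; linarith
        _ = _ := by ring
  · intro n
    simp [ha0 n]
  · intro n r s hrs
    have := hmono n r s hrs
    constructor
    · nlinarith [hk n]
    · nlinarith [hk n]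
  · intro n r s
    have h1 := hsub n r (a n s) (hfin n s)
    have : 0 ≤ (n + 1 : ℝ) * ((s - a n s) - (r - a n r)) ^ 2 := by have := hk n; positivity
    dsimp only
    nlinarith

variable {X : Type*} [MeasurableSpace X]

/-! ### Subdifferentials in `L²` and complete accretivity -/

/-- Membership in the subdifferential of a functional on `L²` that is induced by a functional `E` on
functions, in terms of real numbers, integrals and functions instead of classes. -/
lemma mem_subdifferential_iff {ν : Measure X} {E : (X → ℝ) → ℝ≥0∞}
    (hE : ∀ f g, f =ᵐ[ν] g → E f = E g) (u v : Lp ℝ 2 ν) :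
    (u, v) ∈ subdifferential (fun u : Lp ℝ 2 ν => (E u : EReal)) ↔
      E u ≠ ∞ ∧ ∀ w : X → ℝ, MemLp w 2 ν → E w ≠ ∞ →
        (E u).toReal + ∫ x, v x * (w x - u x) ∂ν ≤ (E w).toReal := by
  have hinner : ∀ w : X → ℝ, ∀ hw : MemLp w 2 ν,
      inner ℝ v (hw.toLp w - u) = ∫ x, v x * (w x - u x) ∂ν := by
    intro w hw
    rw [L2.inner_def]
    refine integral_congr_ae ?_
    filter_upwards [Lp.coeFn_sub (hw.toLp w) u, hw.coeFn_toLp] with x h1 h2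
    rw [h1, Pi.sub_apply, h2]
    simp [mul_comm]
  have hreal : ∀ a b : ℝ≥0∞, a ≠ ∞ → b ≠ ∞ → ∀ r : ℝ,
      ((a : EReal) + (r : EReal) ≤ (b : EReal) ↔ a.toReal + r ≤ b.toReal) := by
    intro a b ha hb r
    rw [← EReal.coe_ennreal_toReal ha, ← EReal.coe_ennreal_toReal hb, ← EReal.coe_add,
      EReal.coe_le_coe_iff]
  have htop : ∀ a : ℝ≥0∞, (a : EReal) ≠ ⊤ ↔ a ≠ ∞ := fun a => by
    rw [Ne, EReal.coe_ennreal_eq_top_iff]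
  constructor
  · rintro ⟨h1, h2⟩
    have h1' := (htop _).1 h1
    refine ⟨h1', fun w hw hEw => ?_⟩
    have h3 := h2 (hw.toLp w)
    have e : E (hw.toLp w) = E w := hE _ _ hw.coeFn_toLp
    simp only [e, hinner] at h3
    exact (hreal _ _ h1' hEw _).1 h3
  · rintro ⟨h1, h2⟩
    refine ⟨(htop _).2 h1, fun w => ?_⟩
    by_cases hEw : E w = ∞
    · simp [hEw]
    · have h3 := h2 w (Lp.memLp w) hEw
      rw [← hinner w (Lp.memLp w), Lp.toLp_coeFn] at h3
      exact (hreal _ _ h1 hEw _).2 h3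

/-- If exchanging mass between `u₁` and `u₂` along normal contractions of `u₁ - u₂` decreases the
sum of energies, the subdifferential is monotone along these contractions. -/
lemma integral_mul_contraction_nonneg {ν : Measure X} {E : (X → ℝ) → ℝ≥0∞}
    (hE : ∀ f g, f =ᵐ[ν] g → E f = E g)
    {u₁ v₁ u₂ v₂ : Lp ℝ 2 ν}
    (h₁ : (u₁, v₁) ∈ subdifferential (fun u : Lp ℝ 2 ν => (E u : EReal)))
    (h₂ : (u₂, v₂) ∈ subdifferential (fun u : Lp ℝ 2 ν => (E u : EReal)))
    {w : X → ℝ} (hw : MemLp w 2 ν)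
    (hEw : E (fun x => u₁ x - w x) + E (fun x => u₂ x + w x) ≤ E u₁ + E u₂) :
    0 ≤ ∫ x, (v₁ x - v₂ x) * w x ∂ν := by
  rw [mem_subdifferential_iff hE] at h₁ h₂
  have hfin : E u₁ + E u₂ ≠ ∞ := ENNReal.add_ne_top.2 ⟨h₁.1, h₂.1⟩
  obtain ⟨f1, f2⟩ := ENNReal.add_ne_top.1 (ne_top_of_le_ne_top hfin hEw)
  have k1 := h₁.2 _ ((Lp.memLp u₁).sub hw) f1
  have k2 := h₂.2 _ ((Lp.memLp u₂).add hw) f2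
  have k3 := ENNReal.toReal_mono hfin hEw
  rw [ENNReal.toReal_add f1 f2, ENNReal.toReal_add h₁.1 h₂.1] at k3
  have i1 : Integrable (fun x => v₁ x * w x) ν := (Lp.memLp v₁).integrable_mul hw
  have i2 : Integrable (fun x => v₂ x * w x) ν := (Lp.memLp v₂).integrable_mul hw
  have e1 : ∫ x, v₁ x * ((u₁ - w : X → ℝ) x - u₁ x) ∂ν = -∫ x, v₁ x * w x ∂ν := by
    rw [← integral_neg]
    congr 1; ext x; simp
  have e2 : ∫ x, v₂ x * ((u₂ + w : X → ℝ) x - u₂ x) ∂ν = ∫ x, v₂ x * w x ∂ν := by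
    congr 1; ext x; simp
  have e3 : ∫ x, (v₁ x - v₂ x) * w x ∂ν = ∫ x, v₁ x * w x ∂ν - ∫ x, v₂ x * w x ∂ν := by
    rw [← integral_sub i1 i2]
    congr 1; ext x; ring
  rw [e1] at k1
  rw [e2] at k2
  rw [e3]
  have e4 : E (u₁ - w : X → ℝ) = E (fun x => u₁ x - w x) := rfl
  have e5 : E (u₂ + w : X → ℝ) = E (fun x => u₂ x + w x) := rfl
  rw [e4] at k1
  rw [e5] at k2
  linarith

/-- A function that is monotone and `K`-Lipschitz, and vanishes at `0`, acts on `L²`. -/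
lemma memLp_comp_of_bounds {ν : Measure X} {q : ℝ → ℝ} {K : ℝ} (hq0 : q 0 = 0)
    (hq : ∀ r s, r ≤ s → 0 ≤ q s - q r ∧ q s - q r ≤ K * (s - r)) {u : X → ℝ}
    (hu : MemLp u 2 ν) : MemLp (fun x => q (u x)) 2 ν := by
  have hmeas : Measurable q :=
    (show Monotone q from fun r s h => by linarith [(hq r s h).1]).measurable
  refine MemLp.of_le_mul (c := K) hu
    (hmeas.comp_aemeasurable hu.aestronglyMeasurable.aemeasurable).aestronglyMeasurable
    (Eventually.of_forall fun x => ?_)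
  rw [Real.norm_eq_abs, Real.norm_eq_abs]
  rcases le_total 0 (u x) with h | h
  · have := hq 0 (u x) h
    rw [hq0] at this
    rw [abs_of_nonneg h, abs_of_nonneg (by linarith)]
    linarith
  · have := hq (u x) 0 h
    rw [hq0] at this
    rw [abs_of_nonpos h, abs_of_nonpos (by linarith)]
    linarith

/-- If `v` is monotone with respect to `u` along all Lipschitz nondecreasing functions of `u`, then
`u` is completely dominated by `u + r v`. The integrands `j` are reduced to their Moreau envelopes
by Fatou's lemma. -/
lemma completelyDominated_of_integral_nonneg {ν : Measure X} {u v : X → ℝ} (hu : MemLp u 2 ν)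
    (hv : MemLp v 2 ν)
    (h : ∀ q : ℝ → ℝ, q 0 = 0 → (∀ r s, r ≤ s → 0 ≤ q s - q r ∧ q s - q r ≤ s - r) →
      0 ≤ ∫ x, v x * q (u x) ∂ν) {r : ℝ} (hr : 0 < r) :
    CompletelyDominated ν u (fun x => u x + r * v x) := by
  intro j hconv hlsc hj0
  obtain ⟨J, Q, hJm, hJ0, hJle, hJj, hJlim, hQ0, hQ, hsub⟩ :=
    exists_moreau_approximation hconv hlsc hj0
  have hint : ∀ n (f : X → ℝ), MemLp f 2 ν → Integrable (fun x => J n (f x)) ν := by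
    intro n f hf
    refine Integrable.mono' (hf.integrable_sq.const_mul ((n : ℝ) + 1))
      ((hJm n).comp_aemeasurable hf.aestronglyMeasurable.aemeasurable).aestronglyMeasurable
      (Eventually.of_forall fun x => ?_)
    rw [Real.norm_of_nonneg (hJ0 _ _)]
    exact hJle _ _
  have hf : MemLp (fun x => u x + r * v x) 2 ν := hu.add (hv.const_mul r)
  have key : ∀ n, ∫⁻ x, ENNReal.ofReal (J n (u x)) ∂ν ≤ ∫⁻ x, j (u x + r * v x) ∂ν := by
    intro n
    have hn : (0 : ℝ) < n + 1 := by positivity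
    refine le_trans ?_ (lintegral_mono fun x => hJj n (u x + r * v x))
    rw [← ofReal_integral_eq_lintegral_ofReal (hint n _ hu)
      (Eventually.of_forall fun x => hJ0 _ _),
      ← ofReal_integral_eq_lintegral_ofReal (hint n _ hf) (Eventually.of_forall fun x => hJ0 _ _)]
    refine ENNReal.ofReal_le_ofReal ?_
    have hq : 0 ≤ ∫ x, v x * ((n + 1 : ℝ)⁻¹ * Q n (u x)) ∂ν := by
      refine h (fun s => (n + 1 : ℝ)⁻¹ * Q n s) (by simp [hQ0]) fun a b hab => ?_
      have := hQ n a b hab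
      rw [← mul_sub]
      exact ⟨mul_nonneg (by positivity) this.1, by
        rw [inv_mul_le_iff₀ hn]; exact this.2⟩
    have hq' : 0 ≤ ∫ x, r * (v x * Q n (u x)) ∂ν := by
      have e : ∫ x, r * (v x * Q n (u x)) ∂ν =
          (r * (n + 1)) * ∫ x, v x * ((n + 1 : ℝ)⁻¹ * Q n (u x)) ∂ν := by
        rw [← integral_const_mul]
        congr 1; ext x; field_simp
      rw [e]
      positivity
    have hQi : Integrable (fun x => r * (v x * Q n (u x))) ν :=
      (hv.integrable_mul (memLp_comp_of_bounds (hQ0 n) (hQ n) hu)).const_mul r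
    calc ∫ x, J n (u x) ∂ν ≤ ∫ x, J n (u x) ∂ν + ∫ x, r * (v x * Q n (u x)) ∂ν := by linarith
      _ = ∫ x, (J n (u x) + r * (v x * Q n (u x))) ∂ν := (integral_add (hint n _ hu) hQi).symm
      _ ≤ ∫ x, J n (u x + r * v x) ∂ν := by
        refine integral_mono ((hint n _ hu).add hQi) (hint n _ hf) fun x => ?_
        have := hsub n (u x) (u x + r * v x)
        dsimp only
        linarith
  calc ∫⁻ x, j (u x) ∂ν
      ≤ ∫⁻ x, liminf (fun n => ENNReal.ofReal (J n (u x))) atTop ∂ν :=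
        lintegral_mono fun x => hJlim _
    _ ≤ liminf (fun n => ∫⁻ x, ENNReal.ofReal (J n (u x)) ∂ν) atTop := by
        refine lintegral_liminf_le' fun n => ?_
        exact ((hJm n).comp_aemeasurable hu.aestronglyMeasurable.aemeasurable).ennreal_ofReal
    _ ≤ ∫⁻ x, j (u x + r * v x) ∂ν :=
        liminf_le_of_frequently_le' (Frequently.of_forall key)

lemma CompletelyDominated.congr {ν : Measure X} {u v u' v' : X → ℝ}
    (h : CompletelyDominated ν u v) (hu : u =ᵐ[ν] u') (hv : v =ᵐ[ν] v') :
    CompletelyDominated ν u' v' := by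
  intro j h1 h2 h3
  have e1 : ∫⁻ x, j (u x) ∂ν = ∫⁻ x, j (u' x) ∂ν :=
    lintegral_congr_ae (hu.mono fun x hx => by simp only [hx])
  have e2 : ∫⁻ x, j (v x) ∂ν = ∫⁻ x, j (v' x) ∂ν :=
    lintegral_congr_ae (hv.mono fun x hx => by simp only [hx])
  rw [← e1, ← e2]
  exact h j h1 h2 h3

/-- The subdifferential of a functional whose sum over pairs decreases under the exchange of normal
contractions of the difference is completely accretive. -/
theorem isCompletelyAccretive_subdifferential {ν : Measure X} {E : (X → ℝ) → ℝ≥0∞}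
    (hE : ∀ f g, f =ᵐ[ν] g → E f = E g)
    (hcontr : ∀ u₁ u₂ : X → ℝ, Measurable u₁ → Measurable u₂ → ∀ q : ℝ → ℝ,
      (∀ r s, r ≤ s → 0 ≤ q s - q r ∧ q s - q r ≤ s - r) →
      E (fun x => u₁ x - q (u₁ x - u₂ x)) + E (fun x => u₂ x + q (u₁ x - u₂ x)) ≤ E u₁ + E u₂) :
    IsCompletelyAccretive (subdifferential (fun u : Lp ℝ 2 ν => (E u : EReal))) := by
  rintro r hr ⟨u₁, v₁⟩ h₁ ⟨u₂, v₂⟩ h₂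
  have hu := (Lp.memLp u₁).sub (Lp.memLp u₂)
  have hv := (Lp.memLp v₁).sub (Lp.memLp v₂)
  refine (completelyDominated_of_integral_nonneg hu hv ?_ hr).congr (Lp.coeFn_sub u₁ u₂).symm ?_
  · intro q hq0 hq
    exact integral_mul_contraction_nonneg hE h₁ h₂
      (memLp_comp_of_bounds (K := 1) hq0 (by simpa using hq) hu)
      (hcontr u₁ u₂ (Lp.stronglyMeasurable u₁).measurable (Lp.stronglyMeasurable u₂).measurable
        q hq)
  · filter_upwards [Lp.coeFn_add (u₁ - u₂) (r • (v₁ - v₂)), Lp.coeFn_sub u₁ u₂,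
      Lp.coeFn_smul r (v₁ - v₂), Lp.coeFn_sub v₁ v₂] with x k1 k2 k3 k4
    rw [k1, Pi.add_apply, k2, k3, Pi.smul_apply, k4, smul_eq_mul]

/-! ### The measures `ν ⊗ m_x` and nonlocal gradients -/

lemma measurePreserving_fst_compProd (m : Kernel X X) [IsMarkovKernel m] (ν : Measure X)
    [SFinite ν] : MeasurePreserving Prod.fst (ν.compProd m) ν :=
  ⟨measurable_fst, Measure.fst_compProd ν m⟩

lemma measurePreserving_snd_compProd {m : Kernel X X} [IsMarkovKernel m] {ν : Measure X}
    [SFinite ν] (h : Kernel.Invariant m ν) : MeasurePreserving Prod.snd (ν.compProd m) ν :=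
  ⟨measurable_snd, (Measure.snd_compProd ν m).trans h⟩

/-- Reversibility says that `ν ⊗ m_x` is symmetric. -/
lemma measurePreserving_swap_compProd {m : Kernel X X} [IsMarkovKernel m] {ν : Measure X}
    [SigmaFinite ν] (h : Kernel.IsReversible m ν) :
    MeasurePreserving Prod.swap (ν.compProd m) (ν.compProd m) := by
  refine ⟨measurable_swap, ?_⟩
  have hrect : ∀ s t : Set X, MeasurableSet s → MeasurableSet t →
      (ν.compProd m).map Prod.swap (s ×ˢ t) = (ν.compProd m) (s ×ˢ t) := by
    intro s t hs ht
    rw [Measure.map_apply measurable_swap (hs.prod ht), Set.preimage_swap_prod,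
      Measure.compProd_apply_prod ht hs, Measure.compProd_apply_prod hs ht]
    exact h ht hs
  refine Measure.ext_of_generateFrom_of_iUnion _ (fun n => spanningSets ν n ×ˢ Set.univ)
    generateFrom_prod.symm isPiSystem_prod ?_ ?_ ?_ ?_
  · rw [← Set.iUnion_prod_const, iUnion_spanningSets, Set.univ_prod_univ]
  · exact fun n => ⟨_, measurableSet_spanningSets ν n, _, MeasurableSet.univ, rfl⟩
  · intro n
    rw [hrect _ _ (measurableSet_spanningSets ν n) MeasurableSet.univ,
      Measure.compProd_apply_prod (measurableSet_spanningSets ν n) MeasurableSet.univ]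
    simpa using (measure_spanningSets_lt_top ν n).ne
  · rintro _ ⟨s, hs, t, ht, rfl⟩
    exact hrect s t hs ht

section Coupling

variable {ν : Measure X} {π : Measure (X × X)}

lemma measurable_nonlocalGrad {u : X → ℝ} (hu : Measurable u) : Measurable (nonlocalGrad u) :=
  (hu.comp measurable_snd).sub (hu.comp measurable_fst)

lemma nonlocalGrad_congr (h₁ : MeasurePreserving Prod.fst π ν)
    (h₂ : MeasurePreserving Prod.snd π ν) {u w : X → ℝ} (h : u =ᵐ[ν] w) :
    nonlocalGrad u =ᵐ[π] nonlocalGrad w := by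
  filter_upwards [h₁.quasiMeasurePreserving.ae_eq_comp h, h₂.quasiMeasurePreserving.ae_eq_comp h]
    with z k1 k2
  simp only [Function.comp_apply] at k1 k2
  simp [nonlocalGrad, k1, k2]

lemma memLp_nonlocalGrad (h₁ : MeasurePreserving Prod.fst π ν)
    (h₂ : MeasurePreserving Prod.snd π ν) {u : X → ℝ} {q : ℝ≥0∞} (h : MemLp u q ν) :
    MemLp (nonlocalGrad u) q π :=
  (h.comp_measurePreserving h₂).sub (h.comp_measurePreserving h₁)

lemma aestronglyMeasurable_nonlocalGrad (h₁ : MeasurePreserving Prod.fst π ν)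
    (h₂ : MeasurePreserving Prod.snd π ν) {u : X → ℝ} (h : AEStronglyMeasurable u ν) :
    AEStronglyMeasurable (nonlocalGrad u) π :=
  (h.comp_measurePreserving h₂).sub (h.comp_measurePreserving h₁)

lemma integral_abs_nonlocalGrad_le (h₁ : MeasurePreserving Prod.fst π ν)
    (h₂ : MeasurePreserving Prod.snd π ν) {u : X → ℝ} (h : Integrable u ν) :
    ∫ z, |nonlocalGrad u z| ∂π ≤ 2 * ∫ x, |u x| ∂ν := by
  have i1 : Integrable (fun z : X × X => |u z.1|) π := (h₁.integrable_comp_of_integrable h).abs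
  have i2 : Integrable (fun z : X × X => |u z.2|) π := (h₂.integrable_comp_of_integrable h).abs
  have e1 : ∫ z : X × X, |u z.1| ∂π = ∫ x, |u x| ∂ν := by
    have := h.abs.aestronglyMeasurable
    rw [← h₁.map_eq] at this ⊢
    exact (integral_map h₁.measurable.aemeasurable this).symm
  have e2 : ∫ z : X × X, |u z.2| ∂π = ∫ x, |u x| ∂ν := by
    have := h.abs.aestronglyMeasurable
    rw [← h₂.map_eq] at this ⊢
    exact (integral_map h₂.measurable.aemeasurable this).symm
  have i3 : Integrable (fun z => |nonlocalGrad u z|) π :=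
    (memLp_one_iff_integrable.1 (memLp_nonlocalGrad h₁ h₂ (memLp_one_iff_integrable.2 h))).abs
  calc ∫ z, |nonlocalGrad u z| ∂π ≤ ∫ z, (|u z.2| + |u z.1|) ∂π :=
        integral_mono i3 (i2.add i1) fun z => abs_sub _ _
    _ = 2 * ∫ x, |u x| ∂ν := by rw [integral_add i2 i1, e1, e2]; ring

/-- The energy `c ∫ f(∇u) dπ`, with values in `[0, +∞]`; `𝓕_{1,m}` and `𝓕_{p,m}` are of this
form. -/
noncomputable def gradEnergy (c : ℝ) (f : ℝ → ℝ) (π : Measure (X × X)) (u : X → ℝ) : ℝ≥0∞ :=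
  ENNReal.ofReal c * ∫⁻ z, ENNReal.ofReal (f (nonlocalGrad u z)) ∂π

lemma gradEnergy_congr (h₁ : MeasurePreserving Prod.fst π ν)
    (h₂ : MeasurePreserving Prod.snd π ν) (c : ℝ) (f : ℝ → ℝ) {u w : X → ℝ} (h : u =ᵐ[ν] w) :
    gradEnergy c f π u = gradEnergy c f π w := by
  unfold gradEnergy
  congr 1
  refine lintegral_congr_ae ?_
  filter_upwards [nonlocalGrad_congr h₁ h₂ h] with z hz
  rw [hz]

lemma gradEnergy_ne_top_iff {c : ℝ} (hc : 0 < c) {f : ℝ → ℝ} (hf : Continuous f)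
    (hf0 : ∀ r, 0 ≤ f r) {u : X → ℝ} (hu : AEStronglyMeasurable (nonlocalGrad u) π) :
    gradEnergy c f π u ≠ ∞ ↔ Integrable (fun z => f (nonlocalGrad u z)) π := by
  have h := lintegral_ofReal_ne_top_iff_integrable (hf.comp_aestronglyMeasurable hu)
    (Eventually.of_forall fun z => hf0 (nonlocalGrad u z))
  rw [← h]
  unfold gradEnergy
  have hc' : ENNReal.ofReal c ≠ 0 := by simpa using hc
  constructor
  · intro h1 h2
    exact h1 (by rw [h2, ENNReal.mul_top hc'])
  · exact fun h1 => ENNReal.mul_ne_top ENNReal.ofReal_ne_top h1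

lemma toReal_gradEnergy {c : ℝ} (hc : 0 < c) {f : ℝ → ℝ}
    (hf0 : ∀ r, 0 ≤ f r) {u : X → ℝ} (hu : Integrable (fun z => f (nonlocalGrad u z)) π) :
    (gradEnergy c f π u).toReal = c * ∫ z, f (nonlocalGrad u z) ∂π := by
  unfold gradEnergy
  rw [ENNReal.toReal_mul, ENNReal.toReal_ofReal hc.le,
    ← ofReal_integral_eq_lintegral_ofReal hu (Eventually.of_forall fun z => hf0 _),
    ENNReal.toReal_ofReal (integral_nonneg fun z => hf0 _)]

lemma gradEnergy_contraction_le {c : ℝ} {f : ℝ → ℝ} (hf : Measurable f) (hf0 : ∀ r, 0 ≤ f r)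
    (hconv : ConvexOn ℝ Set.univ f) {u₁ u₂ : X → ℝ} (hu₁ : Measurable u₁) (hu₂ : Measurable u₂)
    {q : ℝ → ℝ} (hq : ∀ r s, r ≤ s → 0 ≤ q s - q r ∧ q s - q r ≤ s - r) :
    gradEnergy c f π (fun x => u₁ x - q (u₁ x - u₂ x)) +
      gradEnergy c f π (fun x => u₂ x + q (u₁ x - u₂ x)) ≤
    gradEnergy c f π u₁ + gradEnergy c f π u₂ := by
  have hqm : Measurable q :=
    (show Monotone q from fun r s h => by linarith [(hq r s h).1]).measurable
  have hm : ∀ {w : X → ℝ}, Measurable w →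
      Measurable fun z => ENNReal.ofReal (f (nonlocalGrad w z)) :=
    fun hw => (hf.comp (measurable_nonlocalGrad hw)).ennreal_ofReal
  unfold gradEnergy
  rw [← mul_add, ← mul_add, ← lintegral_add_left (hm (by fun_prop)), ← lintegral_add_left (hm hu₁)]
  gcongr ENNReal.ofReal c * ?_
  refine lintegral_mono fun z => ?_
  dsimp only
  rw [← ENNReal.ofReal_add (hf0 _) (hf0 _), ← ENNReal.ofReal_add (hf0 _) (hf0 _)]
  refine ENNReal.ofReal_le_ofReal ?_
  have h := hconv.add_le_of_contraction (a := nonlocalGrad u₁ z) (b := nonlocalGrad u₂ z)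
    (δ := q (u₁ z.2 - u₂ z.2) - q (u₁ z.1 - u₂ z.1)) ?_
  · refine le_trans (le_of_eq ?_) h
    simp only [nonlocalGrad]
    congr 2 <;> ring
  · simp only [nonlocalGrad]
    rcases le_total (u₁ z.1 - u₂ z.1) (u₁ z.2 - u₂ z.2) with h | h
    · have := hq _ _ h
      exact Or.inl ⟨this.1, by linarith⟩
    · have := hq _ _ h
      exact Or.inr ⟨by linarith, by linarith⟩

end Coupling

lemma totalVariation_eq_gradEnergy (m : Kernel X X) (ν : Measure X) (u : X → ℝ) :
    totalVariation m ν u = gradEnergy (1 / 2) (fun r => |r|) (ν.compProd m) u := rfl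

lemma pEnergy_eq_gradEnergy (p : ℝ) (m : Kernel X X) (ν : Measure X) (u : X → ℝ) :
    pEnergy p m ν u = gradEnergy (1 / (2 * p)) (fun r => |r| ^ p) (ν.compProd m) u := rfl

lemma memLp_truncation {ν : Measure X} {w : X → ℝ} {q : ℝ≥0∞} (hw : MemLp w q ν) (n : ℕ) :
    MemLp (fun x => truncation n (w x)) q ν :=
  hw.mono ((continuous_truncation n).comp_aestronglyMeasurable hw.1)
    (Eventually.of_forall fun x => by simpa using abs_truncation_le n (w x))

lemma integrable_truncation {ν : Measure X} {w : X → ℝ} (hw : MemLp w 2 ν) (n : ℕ) :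
    Integrable (fun x => truncation n (w x)) ν :=
  (hw.integrable_sq.const_mul ((n : ℝ) + 1)).mono'
    ((continuous_truncation n).comp_aestronglyMeasurable hw.1)
    (Eventually.of_forall fun x => by simpa using abs_truncation_le_sq n (w x))

lemma abs_nonlocalGrad_truncation_le {Y : Type*} (n : ℕ) (w : Y → ℝ) (z : Y × Y) :
    |nonlocalGrad (fun x => truncation n (w x)) z| ≤ |nonlocalGrad w z| :=
  abs_truncation_sub_le n _ _

lemma tendsto_nonlocalGrad_truncation {Y : Type*} (w : Y → ℝ) (z : Y × Y) :
    Tendsto (fun n => nonlocalGrad (fun x => truncation n (w x)) z) atTop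
      (𝓝 (nonlocalGrad w z)) :=
  (tendsto_truncation _).sub (tendsto_truncation _)

/-- Integrals against a product `v w` are recovered by truncating `w`. -/
lemma tendsto_integral_mul_truncation {ν : Measure X} {v w : X → ℝ} (hv : MemLp v 2 ν)
    (hw : MemLp w 2 ν) :
    Tendsto (fun n => ∫ x, v x * truncation n (w x) ∂ν) atTop (𝓝 (∫ x, v x * w x ∂ν)) := by
  refine tendsto_integral_of_dominated_convergence (fun x => |v x * w x|) (fun n => ?_)
    (hv.integrable_mul hw).abs (fun n => Eventually.of_forall fun x => ?_)
    (Eventually.of_forall fun x => (tendsto_truncation _).const_mul _)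
  · exact (hv.integrable_mul (memLp_truncation hw n)).aestronglyMeasurable
  · rw [norm_mul, abs_mul]
    exact mul_le_mul_of_nonneg_left (abs_truncation_le n _) (abs_nonneg _)

/-! ### Comparison of the two reference measures -/

section Density

variable {ν₁ ν₂ : Measure X}

lemma ofReal_density [SigmaFinite ν₂] :
    ∀ᵐ x ∂ν₁, ENNReal.ofReal (density ν₁ ν₂ x) = ν₂.rnDeriv ν₁ x := by
  filter_upwards [Measure.rnDeriv_lt_top ν₂ ν₁] with x hx
  exact ENNReal.ofReal_toReal hx.ne

lemma le_smul_of_density_le [SigmaFinite ν₁] [SigmaFinite ν₂] (hac : ν₂ ≪ ν₁) {C : ℝ}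
    (hC : ∀ᵐ x ∂ν₁, density ν₁ ν₂ x ≤ C) : ν₂ ≤ ENNReal.ofReal C • ν₁ := by
  rw [← Measure.withDensity_rnDeriv_eq ν₂ ν₁ hac, ← withDensity_const]
  refine withDensity_mono ?_
  filter_upwards [hC, ofReal_density (ν₁ := ν₁) (ν₂ := ν₂)] with x h1 h2
  rw [← h2]
  exact ENNReal.ofReal_le_ofReal h1

lemma le_smul_of_le_density [SigmaFinite ν₁] [SigmaFinite ν₂] (hac : ν₂ ≪ ν₁) {c : ℝ} (hc0 : 0 < c)
    (hc : ∀ᵐ x ∂ν₁, c ≤ density ν₁ ν₂ x) : ν₁ ≤ (ENNReal.ofReal c)⁻¹ • ν₂ := by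
  have h : ENNReal.ofReal c • ν₁ ≤ ν₂ := by
    conv_rhs => rw [← Measure.withDensity_rnDeriv_eq ν₂ ν₁ hac]
    rw [← withDensity_const]
    refine withDensity_mono ?_
    filter_upwards [hc, ofReal_density (ν₁ := ν₁) (ν₂ := ν₂)] with x h1 h2
    rw [← h2]
    exact ENNReal.ofReal_le_ofReal h1
  intro s
  have h2 := h s
  simp only [Measure.smul_apply, smul_eq_mul] at h2 ⊢
  rwa [← ENNReal.mul_le_iff_le_inv (by simpa using hc0) ENNReal.ofReal_ne_top]

lemma exists_density_le (hbdd : MemLp (density ν₁ ν₂) ∞ ν₁) :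
    ∃ C : ℝ, 0 ≤ C ∧ ∀ᵐ x ∂ν₁, density ν₁ ν₂ x ≤ C := by
  refine ⟨(eLpNorm (density ν₁ ν₂) ∞ ν₁).toReal, ENNReal.toReal_nonneg, ?_⟩
  have h := hbdd.2.ne
  rw [eLpNorm_exponent_top] at h ⊢
  filter_upwards [ae_le_eLpNormEssSup (f := density ν₁ ν₂) (μ := ν₁)] with x hx
  have := ENNReal.toReal_mono h hx
  rw [toReal_enorm, Real.norm_eq_abs] at this
  exact (le_abs_self _).trans this

lemma measurable_density : Measurable (density ν₁ ν₂) :=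
  (Measure.measurable_rnDeriv ν₂ ν₁).ennreal_toReal

end Density

/-! ### The flux `|∇u|^{p-2} ∇u` and integration by parts -/

lemma memLp_ofReal_iff_integrable_abs_rpow {Z : Type*} [MeasurableSpace Z] {π : Measure Z} {p : ℝ}
    (hp : 0 < p) {f : Z → ℝ} (hf : AEStronglyMeasurable f π) :
    MemLp f (ENNReal.ofReal p) π ↔ Integrable (fun z => |f z| ^ p) π := by
  have h := integrable_norm_rpow_iff hf (p := ENNReal.ofReal p) (by simpa using hp)
    ENNReal.ofReal_ne_top
  rw [ENNReal.toReal_ofReal hp.le] at h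
  exact h.symm

/-- The flux `|f|^{p-2} f` of a function `f ∈ L² ∩ L^p` belongs to `L¹ + L²` if the measure is
finite or `p ≥ 2`: split it according to whether `|f| > 1`. -/
lemma exists_pFlux_decomposition {Z : Type*} [MeasurableSpace Z] {π : Measure Z} {p : ℝ}
    (hp : 1 < p) (hcase : π Set.univ < ∞ ∨ 2 ≤ p) {f : Z → ℝ} (hf : Measurable f)
    (hf2 : MemLp f 2 π) (hfp : Integrable (fun z => |f z| ^ p) π) :
    ∃ G₁ G₂ : Z → ℝ, Measurable G₁ ∧ Measurable G₂ ∧ (∀ z, pFlux p (f z) = G₁ z + G₂ z) ∧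
      Integrable G₁ π ∧ MemLp G₂ 2 π := by
  have hS : MeasurableSet {z | 1 < |f z|} := measurableSet_lt measurable_const hf.abs
  have hG : Measurable fun z => pFlux p (f z) := (measurable_pFlux p).comp hf
  refine ⟨Set.indicator {z | 1 < |f z|} fun z => pFlux p (f z),
    Set.indicator {z | 1 < |f z|}ᶜ fun z => pFlux p (f z), hG.indicator hS, hG.indicator hS.compl,
    fun z => ?_, ?_, ?_⟩
  · exact (congrFun (Set.indicator_self_add_compl {z | 1 < |f z|} fun z => pFlux p (f z)) z).symm
  · refine hfp.mono' (hG.indicator hS).aestronglyMeasurable (Eventually.of_forall fun z => ?_)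
    by_cases hz : 1 < |f z|
    · rw [Set.indicator_of_mem (by exact hz), Real.norm_eq_abs, abs_pFlux hp]
      exact Real.rpow_le_rpow_of_exponent_le hz.le (by linarith)
    · rw [Set.indicator_of_notMem (by exact hz), norm_zero]
      positivity
  · rcases hcase with hfin | hp2
    · have : IsFiniteMeasure π := ⟨hfin⟩
      refine MemLp.of_bound (hG.indicator hS.compl).aestronglyMeasurable 1
        (Eventually.of_forall fun z => ?_)
      by_cases hz : 1 < |f z|
      · rw [Set.indicator_of_notMem (by simpa using hz)]
        simp
      · rw [Set.indicator_of_mem (by simpa using hz), Real.norm_eq_abs, abs_pFlux hp]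
        exact Real.rpow_le_one (abs_nonneg _) (not_lt.1 hz) (by linarith)
    · refine hf2.mono (hG.indicator hS.compl).aestronglyMeasurable
        (Eventually.of_forall fun z => ?_)
      by_cases hz : 1 < |f z|
      · rw [Set.indicator_of_notMem (by simpa using hz)]
        simp
      · rw [Set.indicator_of_mem (by simpa using hz), Real.norm_eq_abs, abs_pFlux hp,
          Real.norm_eq_abs]
        have := Real.rpow_le_rpow_of_exponent_ge_of_imp (abs_nonneg (f z)) (not_lt.1 hz)
          (show 1 ≤ p - 1 by linarith) (fun _ h => by linarith)
        simpa using this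

lemma memLp_two_integral_kernel {m : Kernel X X} [IsMarkovKernel m] {ν : Measure X} [SFinite ν]
    {G : X × X → ℝ} (hG : Measurable G) (h : MemLp G 2 (ν.compProd m)) :
    MemLp (fun x => ∫ y, G (x, y) ∂(m x)) 2 ν := by
  have hm : StronglyMeasurable fun x => ∫ y, G (x, y) ∂(m x) :=
    hG.stronglyMeasurable.integral_kernel_prod_right'
  rw [memLp_two_iff_integrable_sq hm.aestronglyMeasurable]
  have hsq := h.integrable_sq
  have hsq' := (Measure.integrable_compProd_iff hsq.aestronglyMeasurable).1 hsq
  refine hsq'.2.mono' (hm.pow 2).aestronglyMeasurable ?_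
  filter_upwards [hsq'.1] with x hx
  have hx2 : MemLp (fun y => G (x, y)) 2 (m x) :=
    (memLp_two_iff_integrable_sq
      (hG.comp measurable_prodMk_left).aestronglyMeasurable).2 hx
  have hvar := variance_eq_sub hx2
  have hnn := variance_nonneg (fun y => G (x, y)) (m x)
  rw [hvar] at hnn
  rw [Real.norm_of_nonneg (sq_nonneg _)]
  simp only [norm_pow, Real.norm_eq_abs, sq_abs]
  simpa using hnn

/-- The `p`-Laplacian of a function, as the integral of the flux `|∇u|^{p-2} ∇u` over `m_x`. -/
noncomputable def pLap (p : ℝ) (m : Kernel X X) (u : X → ℝ) (x : X) : ℝ :=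
  ∫ y, pFlux p (nonlocalGrad u (x, y)) ∂(m x)

/-- The divergence of the antisymmetric flux `|∇u|^{p-2} ∇u` at `x` is its integral over `m_x`. -/
lemma nonlocalDiv_pFlux (p : ℝ) (m : Kernel X X) (u : X → ℝ) (x : X) :
    nonlocalDiv m (fun z => |nonlocalGrad u z| ^ (p - 2) * nonlocalGrad u z) x =
      pLap p m u x := by
  unfold nonlocalDiv pLap
  rw [← integral_const_mul]
  congr 1; ext y
  have h : nonlocalGrad u (y, x) = -nonlocalGrad u (x, y) := by simp [nonlocalGrad]
  have h2 := pFlux_neg p (nonlocalGrad u (x, y))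
  simp only [pFlux, h] at h2 ⊢
  linarith

section PFlux

variable {m : Kernel X X} [IsMarkovKernel m] {ν : Measure X} [SigmaFinite ν] {p : ℝ} {u : X → ℝ}

lemma stronglyMeasurable_pLap (hu : Measurable u) : StronglyMeasurable (pLap p m u) :=
  ((measurable_pFlux p).comp
    (measurable_nonlocalGrad hu)).stronglyMeasurable.integral_kernel_prod_right'

lemma pLap_congr (hinv : Kernel.Invariant m ν) {w : X → ℝ} (h : u =ᵐ[ν] w) :
    pLap p m u =ᵐ[ν] pLap p m w := by
  have h' := nonlocalGrad_congr (measurePreserving_fst_compProd m ν)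
    (measurePreserving_snd_compProd hinv) h
  filter_upwards [Measure.ae_ae_of_ae_compProd h'] with x hx
  refine integral_congr_ae ?_
  filter_upwards [hx] with y hy
  rw [hy]

lemma compProd_univ_lt_top_or (hcase : ν Set.univ < ∞ ∨ 2 ≤ p) :
    (ν.compProd m) Set.univ < ∞ ∨ 2 ≤ p := by
  refine hcase.imp_left fun h => ?_
  have := (measurePreserving_fst_compProd m ν).measure_preimage nullMeasurableSet_univ
  rw [Set.preimage_univ] at this
  rwa [this]

/-- The `p`-Laplacian `x ↦ ∫ |∇u|^{p-2} ∇u dm_x` belongs to `L¹ + L²`. -/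
lemma exists_integral_pFlux_decomposition (hrev : Kernel.IsReversible m ν) (hp : 1 < p)
    (hcase : ν Set.univ < ∞ ∨ 2 ≤ p) (hu : Measurable u) (hu2 : MemLp u 2 ν)
    (hup : Integrable (fun z => |nonlocalGrad u z| ^ p) (ν.compProd m)) :
    ∃ D₁ D₂ : X → ℝ, Integrable D₁ ν ∧ MemLp D₂ 2 ν ∧
      ∀ᵐ x ∂ν, pLap p m u x = D₁ x + D₂ x := by
  have h₁ := measurePreserving_fst_compProd m ν
  have h₂ := measurePreserving_snd_compProd hrev.invariant
  obtain ⟨G₁, G₂, hm₁, hm₂, hG, hi₁, hi₂⟩ := exists_pFlux_decomposition hp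
    (compProd_univ_lt_top_or hcase) (measurable_nonlocalGrad hu) (memLp_nonlocalGrad h₁ h₂ hu2) hup
  refine ⟨fun x => ∫ y, G₁ (x, y) ∂(m x), fun x => ∫ y, G₂ (x, y) ∂(m x), ?_,
    memLp_two_integral_kernel hm₂ hi₂, ?_⟩
  · have := (Measure.integrable_compProd_iff hi₁.aestronglyMeasurable).1 hi₁
    refine this.2.mono'
      hm₁.stronglyMeasurable.integral_kernel_prod_right'.aestronglyMeasurable
      (Eventually.of_forall fun x => norm_integral_le_integral_norm _)
  · have k1 := (Measure.integrable_compProd_iff hi₁.aestronglyMeasurable).1 hi₁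
    have hsq := hi₂.integrable_sq
    have k2 := (Measure.integrable_compProd_iff hsq.aestronglyMeasurable).1 hsq
    filter_upwards [k1.1, k2.1] with x hx1 hx2
    have hx2' : MemLp (fun y => G₂ (x, y)) 2 (m x) :=
      (memLp_two_iff_integrable_sq
        (hm₂.comp measurable_prodMk_left).aestronglyMeasurable).2 hx2
    simp only [pLap, hG]
    exact integral_add hx1 (hx2'.integrable one_le_two)

lemma integrable_pFlux_mul (hrev : Kernel.IsReversible m ν) (hp : 1 < p)
    (hcase : ν Set.univ < ∞ ∨ 2 ≤ p) (hu : Measurable u) (hu2 : MemLp u 2 ν)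
    (hup : Integrable (fun z => |nonlocalGrad u z| ^ p) (ν.compProd m)) {h : X × X → ℝ}
    (hh : MemLp h 2 (ν.compProd m)) {M : ℝ} (hM : ∀ᵐ z ∂(ν.compProd m), |h z| ≤ M) :
    Integrable (fun z => pFlux p (nonlocalGrad u z) * h z) (ν.compProd m) := by
  have h₁ := measurePreserving_fst_compProd m ν
  have h₂ := measurePreserving_snd_compProd hrev.invariant
  obtain ⟨G₁, G₂, hm₁, hm₂, hG, hi₁, hi₂⟩ := exists_pFlux_decomposition hp
    (compProd_univ_lt_top_or hcase) (measurable_nonlocalGrad hu) (memLp_nonlocalGrad h₁ h₂ hu2) hup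
  simp only [hG, add_mul]
  exact (hi₁.mul_bdd hh.1 hM).add (hi₂.integrable_mul hh)

/-- Integration by parts, which uses the symmetry of `ν ⊗ m_x`. -/
lemma integral_pFlux_mul_nonlocalGrad (hrev : Kernel.IsReversible m ν) (hp : 1 < p)
    (hcase : ν Set.univ < ∞ ∨ 2 ≤ p) (hu : Measurable u) (hu2 : MemLp u 2 ν)
    (hup : Integrable (fun z => |nonlocalGrad u z| ^ p) (ν.compProd m)) {h : X → ℝ}
    (hh : MemLp h 2 ν) {M : ℝ} (hM : ∀ᵐ x ∂ν, |h x| ≤ M) :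
    Integrable (fun x => pLap p m u x * h x) ν ∧
    (1 / 2) * ∫ z, pFlux p (nonlocalGrad u z) * nonlocalGrad h z ∂(ν.compProd m) =
      -∫ x, pLap p m u x * h x ∂ν := by
  have h₁ := measurePreserving_fst_compProd m ν
  have h₂ := measurePreserving_snd_compProd hrev.invariant
  have hs := measurePreserving_swap_compProd hrev
  have i1 : Integrable (fun z => pFlux p (nonlocalGrad u z) * h z.1) (ν.compProd m) :=
    integrable_pFlux_mul hrev hp hcase hu hu2 hup (hh.comp_measurePreserving h₁)
      (h₁.quasiMeasurePreserving.ae hM)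
  have i2 : Integrable (fun z => pFlux p (nonlocalGrad u z) * h z.2) (ν.compProd m) :=
    integrable_pFlux_mul hrev hp hcase hu hu2 hup (hh.comp_measurePreserving h₂)
      (h₂.quasiMeasurePreserving.ae hM)
  have e1 : ∫ z, pFlux p (nonlocalGrad u z) * h z.1 ∂(ν.compProd m) =
      ∫ x, pLap p m u x * h x ∂ν := by
    rw [Measure.integral_compProd i1]
    congr 1; ext x
    exact integral_mul_const (h x) _
  have e2 : ∫ z, pFlux p (nonlocalGrad u z) * h z.2 ∂(ν.compProd m) =
      -∫ z, pFlux p (nonlocalGrad u z) * h z.1 ∂(ν.compProd m) := by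
    have := hs.integral_comp MeasurableEquiv.prodComm.measurableEmbedding
      (fun z => pFlux p (nonlocalGrad u z) * h z.2)
    rw [← this, ← integral_neg]
    congr 1; ext z
    have hz : nonlocalGrad u z.swap = -nonlocalGrad u z := by simp [nonlocalGrad]
    rw [hz, pFlux_neg, Prod.snd_swap]
    ring
  refine ⟨?_, ?_⟩
  · have := i1.integral_compProd
    refine (this.congr (Eventually.of_forall fun x => ?_))
    simp only [Kernel.prodMkLeft_apply]
    exact integral_mul_const (h x) _
  · have e3 : ∫ z, pFlux p (nonlocalGrad u z) * nonlocalGrad h z ∂(ν.compProd m) =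
        ∫ z, pFlux p (nonlocalGrad u z) * h z.2 ∂(ν.compProd m) -
          ∫ z, pFlux p (nonlocalGrad u z) * h z.1 ∂(ν.compProd m) := by
      rw [← integral_sub i2 i1]
      congr 1; ext z
      simp only [nonlocalGrad]; ring
    rw [e3, e2, ← e1]
    ring

/-- Integration by parts for test functions `h ∈ L²` with `∇h ∈ L^p`, when the `p`-Laplacian is in
`L²`: truncate `h`. -/
lemma integral_pFlux_mul_nonlocalGrad_of_memLp (hrev : Kernel.IsReversible m ν) (hp : 1 < p)
    (hcase : ν Set.univ < ∞ ∨ 2 ≤ p) (hu : Measurable u) (hu2 : MemLp u 2 ν)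
    (hup : Integrable (fun z => |nonlocalGrad u z| ^ p) (ν.compProd m))
    (hD : MemLp (pLap p m u) 2 ν) {h : X → ℝ} (hh : MemLp h 2 ν)
    (hhp : Integrable (fun z => pFlux p (nonlocalGrad u z) * nonlocalGrad h z) (ν.compProd m)) :
    (1 / 2) * ∫ z, pFlux p (nonlocalGrad u z) * nonlocalGrad h z ∂(ν.compProd m) =
      -∫ x, pLap p m u x * h x ∂ν := by
  have h₁ := measurePreserving_fst_compProd m ν
  have h₂ := measurePreserving_snd_compProd hrev.invariant
  have hlim : Tendsto (fun n => (1 / 2) * ∫ z, pFlux p (nonlocalGrad u z) *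
      nonlocalGrad (fun x => truncation n (h x)) z ∂(ν.compProd m)) atTop
      (𝓝 ((1 / 2) * ∫ z, pFlux p (nonlocalGrad u z) * nonlocalGrad h z ∂(ν.compProd m))) := by
    refine Tendsto.const_mul _ (tendsto_integral_of_dominated_convergence
      (fun z => |pFlux p (nonlocalGrad u z) * nonlocalGrad h z|) (fun n => ?_) hhp.abs
      (fun n => Eventually.of_forall fun z => ?_)
      (Eventually.of_forall fun z => (tendsto_nonlocalGrad_truncation h z).const_mul _))
    · exact ((measurable_pFlux p).comp (measurable_nonlocalGrad hu)).aestronglyMeasurable.mul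
        (aestronglyMeasurable_nonlocalGrad h₁ h₂ (memLp_truncation hh n).1)
    · rw [norm_mul, abs_mul]
      exact mul_le_mul_of_nonneg_left (abs_nonlocalGrad_truncation_le n h z) (abs_nonneg _)
  refine tendsto_nhds_unique hlim ((tendsto_integral_mul_truncation hD hh).neg.congr fun n => ?_)
  exact (integral_pFlux_mul_nonlocalGrad hrev hp hcase hu hu2 hup (memLp_truncation hh n)
    (Eventually.of_forall fun x => abs_truncation_le_const n _)).2.symm

end PFlux

lemma abs_pFlux_mul_le {p : ℝ} (hp : 1 < p) {a b t : ℝ} (ht0 : 0 ≤ t) (ht1 : t ≤ 1) :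
    |pFlux p (a + t * b) * b| ≤ |(|a| + |b|)| ^ p := by
  have hab : 0 ≤ |a| + |b| := by positivity
  rw [abs_mul, abs_pFlux hp, abs_of_nonneg hab]
  have h1 : |a + t * b| ≤ |a| + |b| := by
    refine (abs_add_le _ _).trans ?_
    rw [abs_mul, abs_of_nonneg ht0]
    nlinarith [abs_nonneg b]
  calc |a + t * b| ^ (p - 1) * |b| ≤ (|a| + |b|) ^ (p - 1) * (|a| + |b|) := by
        gcongr
        linarith [abs_nonneg a]
    _ = (|a| + |b|) ^ p := by
        rcases hab.eq_or_lt with h | h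
        · rw [← h, mul_zero, Real.zero_rpow (by linarith)]
        · rw [← Real.rpow_add_one h.ne']; congr 1; ring

section Limits

variable {Z : Type*} [MeasurableSpace Z] {π : Measure Z} {p : ℝ} {a b : Z → ℝ}

lemma integrable_abs_add_abs_rpow (hp : 1 < p) (ha : AEStronglyMeasurable a π)
    (hb : AEStronglyMeasurable b π) (hap : Integrable (fun z => |a z| ^ p) π)
    (hbp : Integrable (fun z => |b z| ^ p) π) :
    Integrable (fun z => |(|a z| + |b z|)| ^ p) π := by
  have hp0 : 0 < p := by linarith
  have ha' := (memLp_ofReal_iff_integrable_abs_rpow hp0 ha).2 hap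
  have hb' := (memLp_ofReal_iff_integrable_abs_rpow hp0 hb).2 hbp
  exact (memLp_ofReal_iff_integrable_abs_rpow hp0
    (ha'.abs.add hb'.abs).1).1 (ha'.abs.add hb'.abs)

lemma integrable_abs_add_rpow (hp : 1 < p) (ha : AEStronglyMeasurable a π)
    (hb : AEStronglyMeasurable b π) (hap : Integrable (fun z => |a z| ^ p) π)
    (hbp : Integrable (fun z => |b z| ^ p) π) (t : ℝ) :
    Integrable (fun z => |a z + t * b z| ^ p) π := by
  have hp0 : 0 < p := by linarith
  have ha' := (memLp_ofReal_iff_integrable_abs_rpow hp0 ha).2 hap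
  have hb' := (memLp_ofReal_iff_integrable_abs_rpow hp0 hb).2 hbp
  exact (memLp_ofReal_iff_integrable_abs_rpow hp0 (ha'.add (hb'.const_mul t)).1).1
    (ha'.add (hb'.const_mul t))

lemma integrable_pFlux_add_mul (hp : 1 < p) (ha : AEStronglyMeasurable a π)
    (hb : AEStronglyMeasurable b π) (hap : Integrable (fun z => |a z| ^ p) π)
    (hbp : Integrable (fun z => |b z| ^ p) π) {t : ℝ} (ht0 : 0 ≤ t) (ht1 : t ≤ 1) :
    Integrable (fun z => pFlux p (a z + t * b z) * b z) π :=
  (integrable_abs_add_abs_rpow hp ha hb hap hbp).mono'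
    (((continuous_pFlux hp).comp_aestronglyMeasurable (ha.add (hb.const_mul t))).mul hb)
    (Eventually.of_forall fun _ => abs_pFlux_mul_le hp ht0 ht1)

/-- The derivative of `t ↦ ∫ |a + t b|^p / p` is right continuous at `t = 0`. -/
lemma tendsto_integral_pFlux_add_mul (hp : 1 < p) (ha : AEStronglyMeasurable a π)
    (hb : AEStronglyMeasurable b π) (hap : Integrable (fun z => |a z| ^ p) π)
    (hbp : Integrable (fun z => |b z| ^ p) π) :
    Tendsto (fun n : ℕ => ∫ z, pFlux p (a z + 1 / ((n : ℝ) + 1) * b z) * b z ∂π) atTop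
      (𝓝 (∫ z, pFlux p (a z) * b z ∂π)) := by
  have ht0 : ∀ n : ℕ, (0 : ℝ) ≤ 1 / (n + 1) := fun n => by positivity
  have ht1 : ∀ n : ℕ, (1 : ℝ) / (n + 1) ≤ 1 := fun n =>
    div_le_one_of_le₀ (by linarith [Nat.cast_nonneg (α := ℝ) n]) (by positivity)
  refine tendsto_integral_of_dominated_convergence (fun z => |(|a z| + |b z|)| ^ p)
    (fun n => (integrable_pFlux_add_mul hp ha hb hap hbp (ht0 n) (ht1 n)).aestronglyMeasurable)
    (integrable_abs_add_abs_rpow hp ha hb hap hbp)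
    (fun n => Eventually.of_forall fun z => abs_pFlux_mul_le hp (ht0 n) (ht1 n))
    (Eventually.of_forall fun z => ?_)
  have h := tendsto_one_div_add_atTop_nhds_zero_nat (𝕜 := ℝ)
  have h2 : Tendsto (fun n : ℕ => a z + 1 / ((n : ℝ) + 1) * b z) atTop (𝓝 (a z)) := by
    simpa using (h.mul_const (b z)).const_add (a z)
  exact (((continuous_pFlux hp).tendsto _).comp h2).mul_const _

lemma integral_abs_rpow_add_le (hp : 1 < p) (ha : AEStronglyMeasurable a π)
    (hb : AEStronglyMeasurable b π) (hap : Integrable (fun z => |a z| ^ p) π)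
    (hbp : Integrable (fun z => |b z| ^ p) π) {t : ℝ} (ht0 : 0 ≤ t) (ht1 : t ≤ 1) :
    ∫ z, |a z + t * b z| ^ p ∂π ≤
      ∫ z, |a z| ^ p ∂π + p * t * ∫ z, pFlux p (a z + t * b z) * b z ∂π := by
  have hi := integrable_pFlux_add_mul hp ha hb hap hbp ht0 ht1
  rw [← integral_const_mul, ← integral_add hap (hi.const_mul _)]
  refine integral_mono (integrable_abs_add_rpow hp ha hb hap hbp t)
    (hap.add (hi.const_mul _)) fun z => ?_
  have := abs_rpow_add_pFlux_le hp (a z + t * b z) (a z)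
  dsimp only
  linarith

lemma integrable_abs_rpow_of_bounded (hp : 1 < p) (ha : Integrable a π) {M : ℝ}
    (hM : ∀ᵐ z ∂π, |a z| ≤ M) : Integrable (fun z => |a z| ^ p) π := by
  have hm : AEStronglyMeasurable (fun z => |a z| ^ p) π :=
    (continuous_abs.rpow_const fun _ => Or.inr (by linarith)).comp_aestronglyMeasurable ha.1
  refine (ha.abs.const_mul (M ^ (p - 1))).mono' hm ?_
  filter_upwards [hM] with z hz
  rw [Real.norm_of_nonneg (by positivity)]
  rcases (abs_nonneg (a z)).eq_or_lt with h | h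
  · rw [← h, Real.zero_rpow (by linarith), mul_zero]
  · calc |a z| ^ p = |a z| ^ (p - 1) * |a z| := by
          rw [← Real.rpow_add_one h.ne']; congr 1; ring
      _ ≤ M ^ (p - 1) * |a z| := by gcongr

end Limits

/-- A bounded function in `L² + L¹` belongs to `L²`. -/
lemma memLp_two_of_bounded_of_add {ν : Measure X} {V a b : X → ℝ} (hV : AEStronglyMeasurable V ν)
    (hV1 : ∀ᵐ x ∂ν, |V x| ≤ 1) (ha : MemLp a 2 ν) (hb : Integrable b ν)
    (h : ∀ᵐ x ∂ν, V x = a x + b x) : MemLp V 2 ν := by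
  rw [memLp_two_iff_integrable_sq hV]
  refine ((ha.integrable_sq.const_mul 4).add (hb.abs.const_mul 2)).mono' (hV.pow 2) ?_
  filter_upwards [hV1, h] with x h1 h2
  rw [Real.norm_of_nonneg (sq_nonneg _), ← sq_abs (V x)]
  have h3 : |V x| ≤ |a x| + |b x| := h2 ▸ abs_add_le _ _
  have h0 := abs_nonneg (V x)
  have hb0 := abs_nonneg (b x)
  simp only [Pi.add_apply]
  rw [← sq_abs (a x)]
  rcases le_total |a x| |b x| with hab | hab
  · nlinarith [sq_nonneg |a x|]
  · nlinarith [abs_nonneg (a x)]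

/-! ### The subdifferentials of the energies in terms of integrals -/

lemma continuous_abs_rpow {p : ℝ} (hp : 1 < p) : Continuous fun r : ℝ => |r| ^ p :=
  continuous_abs.rpow_const fun _ => Or.inr (by linarith)

lemma mem_subdifferential_totalVariation_iff {m : Kernel X X} [IsMarkovKernel m] {ν : Measure X}
    [SFinite ν] (hinv : Kernel.Invariant m ν) (u v : Lp ℝ 2 ν) :
    (u, v) ∈ subdifferential (fun u : Lp ℝ 2 ν => (totalVariation m ν u : EReal)) ↔
      Integrable (fun z => |nonlocalGrad u z|) (ν.compProd m) ∧ ∀ w : X → ℝ, MemLp w 2 ν →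
        Integrable (fun z => |nonlocalGrad w z|) (ν.compProd m) →
        1 / 2 * ∫ z, |nonlocalGrad u z| ∂(ν.compProd m) + ∫ x, v x * (w x - u x) ∂ν ≤
          1 / 2 * ∫ z, |nonlocalGrad w z| ∂(ν.compProd m) := by
  have h₁ := measurePreserving_fst_compProd m ν
  have h₂ := measurePreserving_snd_compProd hinv
  have hc : (0 : ℝ) < 1 / 2 := by norm_num
  have hiff : ∀ w : X → ℝ, MemLp w 2 ν → (totalVariation m ν w ≠ ∞ ↔
      Integrable (fun z => |nonlocalGrad w z|) (ν.compProd m)) := fun w hw =>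
    gradEnergy_ne_top_iff hc continuous_abs abs_nonneg
      (aestronglyMeasurable_nonlocalGrad h₁ h₂ hw.1)
  have hval : ∀ w : X → ℝ, Integrable (fun z => |nonlocalGrad w z|) (ν.compProd m) →
      (totalVariation m ν w).toReal = 1 / 2 * ∫ z, |nonlocalGrad w z| ∂(ν.compProd m) :=
    fun w hw => toReal_gradEnergy hc abs_nonneg hw
  rw [mem_subdifferential_iff (E := totalVariation m ν)
    (fun f g h => gradEnergy_congr h₁ h₂ _ _ h), hiff u (Lp.memLp u)]
  refine and_congr_right fun hu => forall_congr' fun w => forall_congr' fun hw => ?_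
  rw [hiff w hw]
  refine forall_congr' fun hw' => ?_
  rw [hval u hu, hval w hw']

lemma onePEnergy_eq (p : ℝ) (m₁ m₂ : Kernel X X) (ν₁ ν₂ : Measure X) :
    onePEnergy p m₁ m₂ ν₁ ν₂ = fun u : Lp ℝ 2 ν₁ =>
    ((totalVariation m₁ ν₁ u + pEnergy p m₂ ν₂ u : ℝ≥0∞) : EReal) := by
  funext u
  rw [EReal.coe_ennreal_add]
  rfl

section Operators

variable {m₁ m₂ : Kernel X X} [IsMarkovKernel m₁] [IsMarkovKernel m₂] {ν₁ ν₂ : Measure X}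
  [SigmaFinite ν₁] [SigmaFinite ν₂] {p : ℝ}

lemma energy_congr (hinv₁ : Kernel.Invariant m₁ ν₁) (hinv₂ : Kernel.Invariant m₂ ν₂)
    (hac : ν₂ ≪ ν₁) {f g : X → ℝ} (h : f =ᵐ[ν₁] g) :
    totalVariation m₁ ν₁ f + pEnergy p m₂ ν₂ f = totalVariation m₁ ν₁ g + pEnergy p m₂ ν₂ g := by
  have e1 : totalVariation m₁ ν₁ f = totalVariation m₁ ν₁ g :=
    gradEnergy_congr (measurePreserving_fst_compProd m₁ ν₁)
      (measurePreserving_snd_compProd hinv₁) _ _ h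
  have e2 : pEnergy p m₂ ν₂ f = pEnergy p m₂ ν₂ g :=
    gradEnergy_congr (measurePreserving_fst_compProd m₂ ν₂)
      (measurePreserving_snd_compProd hinv₂) (1 / (2 * p)) (fun r => |r| ^ p) (hac.ae_eq h)
  rw [e1, e2]

lemma mem_subdifferential_onePEnergy_iff (hinv₁ : Kernel.Invariant m₁ ν₁)
    (hinv₂ : Kernel.Invariant m₂ ν₂) (hac : ν₂ ≪ ν₁) (hp : 1 < p) (u v : Lp ℝ 2 ν₁) :
    (u, v) ∈ subdifferential (onePEnergy p m₁ m₂ ν₁ ν₂) ↔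
      (Integrable (fun z => |nonlocalGrad u z|) (ν₁.compProd m₁) ∧
        Integrable (fun z => |nonlocalGrad u z| ^ p) (ν₂.compProd m₂)) ∧
      ∀ w : X → ℝ, MemLp w 2 ν₁ → Integrable (fun z => |nonlocalGrad w z|) (ν₁.compProd m₁) →
        Integrable (fun z => |nonlocalGrad w z| ^ p) (ν₂.compProd m₂) →
        1 / 2 * ∫ z, |nonlocalGrad u z| ∂(ν₁.compProd m₁) +
          1 / (2 * p) * ∫ z, |nonlocalGrad u z| ^ p ∂(ν₂.compProd m₂) +
          ∫ x, v x * (w x - u x) ∂ν₁ ≤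
        1 / 2 * ∫ z, |nonlocalGrad w z| ∂(ν₁.compProd m₁) +
          1 / (2 * p) * ∫ z, |nonlocalGrad w z| ^ p ∂(ν₂.compProd m₂) := by
  have h₁ := measurePreserving_fst_compProd m₁ ν₁
  have h₂ := measurePreserving_snd_compProd hinv₁
  have k₁ := measurePreserving_fst_compProd m₂ ν₂
  have k₂ := measurePreserving_snd_compProd hinv₂
  have hc : (0 : ℝ) < 1 / 2 := by norm_num
  have hcp : (0 : ℝ) < 1 / (2 * p) := by positivity
  have hnn : ∀ r : ℝ, 0 ≤ |r| ^ p := fun r => by positivity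
  have hiff : ∀ w : X → ℝ, MemLp w 2 ν₁ → (totalVariation m₁ ν₁ w + pEnergy p m₂ ν₂ w ≠ ∞ ↔
      Integrable (fun z => |nonlocalGrad w z|) (ν₁.compProd m₁) ∧
        Integrable (fun z => |nonlocalGrad w z| ^ p) (ν₂.compProd m₂)) := fun w hw => by
    rw [ENNReal.add_ne_top]
    exact and_congr (gradEnergy_ne_top_iff hc continuous_abs abs_nonneg
      (aestronglyMeasurable_nonlocalGrad h₁ h₂ hw.1))
      (gradEnergy_ne_top_iff hcp (continuous_abs_rpow hp) hnn
        (aestronglyMeasurable_nonlocalGrad k₁ k₂ (hw.1.mono_ac hac)))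
  have hval : ∀ w : X → ℝ, MemLp w 2 ν₁ →
      Integrable (fun z => |nonlocalGrad w z|) (ν₁.compProd m₁) →
      Integrable (fun z => |nonlocalGrad w z| ^ p) (ν₂.compProd m₂) →
      (totalVariation m₁ ν₁ w + pEnergy p m₂ ν₂ w).toReal =
        1 / 2 * ∫ z, |nonlocalGrad w z| ∂(ν₁.compProd m₁) +
          1 / (2 * p) * ∫ z, |nonlocalGrad w z| ^ p ∂(ν₂.compProd m₂) := fun w hw i1 i2 => by
    obtain ⟨t1, t2⟩ := ENNReal.add_ne_top.1 ((hiff w hw).2 ⟨i1, i2⟩)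
    rw [ENNReal.toReal_add t1 t2]
    congr 1
    · exact toReal_gradEnergy hc abs_nonneg i1
    · exact toReal_gradEnergy hcp hnn i2
  rw [onePEnergy_eq,
    mem_subdifferential_iff (E := fun w => totalVariation m₁ ν₁ w + pEnergy p m₂ ν₂ w)
    (fun f g h => energy_congr hinv₁ hinv₂ hac h), hiff u (Lp.memLp u)]
  refine and_congr_right fun hu => forall_congr' fun w => forall_congr' fun hw => ?_
  rw [hiff w hw, and_imp]
  refine forall_congr' fun i1 => forall_congr' fun i2 => ?_
  rw [hval u (Lp.memLp u) hu.1 hu.2, hval w hw i1 i2]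

/-! ### Complete accretivity -/

theorem isCompletelyAccretive_subdifferential_onePEnergy (hinv₁ : Kernel.Invariant m₁ ν₁)
    (hinv₂ : Kernel.Invariant m₂ ν₂) (hac : ν₂ ≪ ν₁) (hp : 1 < p) :
    IsCompletelyAccretive (subdifferential (onePEnergy p m₁ m₂ ν₁ ν₂)) := by
  rw [onePEnergy_eq]
  refine isCompletelyAccretive_subdifferential
    (E := fun w => totalVariation m₁ ν₁ w + pEnergy p m₂ ν₂ w)
    (fun f g h => energy_congr hinv₁ hinv₂ hac h) fun u₁ u₂ hu₁ hu₂ q hq => ?_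
  have c1 := gradEnergy_contraction_le (c := 1 / 2) (π := ν₁.compProd m₁)
    continuous_abs.measurable abs_nonneg (convexOn_norm (E := ℝ) convex_univ) hu₁ hu₂ hq
  have c2 := gradEnergy_contraction_le (c := 1 / (2 * p)) (π := ν₂.compProd m₂)
    (continuous_abs_rpow hp).measurable (fun r => by positivity) (convexOn_abs_rpow hp.le)
    hu₁ hu₂ hq
  simp only [totalVariation_eq_gradEnergy, pEnergy_eq_gradEnergy]
  refine (le_of_eq ?_).trans ((add_le_add c1 c2).trans (le_of_eq ?_))
  · exact add_add_add_comm _ _ _ _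
  · exact add_add_add_comm _ _ _ _

/-! ### The inclusion of the sum of the operators in the subdifferential of the sum -/

lemma integral_density_mul (hac : ν₂ ≪ ν₁) (f : X → ℝ) :
    ∫ x, density ν₁ ν₂ x * f x ∂ν₁ = ∫ x, f x ∂ν₂ := by
  simpa [density] using integral_rnDeriv_smul (f := f) hac

lemma integrable_density_mul (hac : ν₂ ≪ ν₁) {f : X → ℝ} :
    Integrable (fun x => density ν₁ ν₂ x * f x) ν₁ ↔ Integrable f ν₂ := by
  simpa [density] using integrable_rnDeriv_smul_iff (f := f) hac

theorem onePLaplacian_subset_subdifferential (hinv₁ : Kernel.Invariant m₁ ν₁)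
    (hrev₂ : Kernel.IsReversible m₂ ν₂) (hac : ν₂ ≪ ν₁)
    (hbdd : MemLp (density ν₁ ν₂) ∞ ν₁) (hp : 1 < p) (hcase : ν₂ Set.univ < ∞ ∨ 2 ≤ p) :
    onePLaplacian p m₁ m₂ ν₁ ν₂ ⊆ subdifferential (onePEnergy p m₁ m₂ ν₁ ν₂) := by
  rintro ⟨u, v⟩ ⟨v₁, u₂, v₂, h1, ⟨h2, h3⟩, hu₂, hv⟩
  have k₁ := measurePreserving_fst_compProd m₂ ν₂
  have k₂ := measurePreserving_snd_compProd hrev₂.invariant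
  have hp0 : 0 < p := by linarith
  obtain ⟨C, -, hC⟩ := exists_density_le hbdd
  have hle := le_smul_of_density_le hac hC
  have hL2 : ∀ {w : X → ℝ}, MemLp w 2 ν₁ → MemLp w 2 ν₂ :=
    fun hw => hw.of_measure_le_smul ENNReal.ofReal_ne_top hle
  have hum : Measurable u := (Lp.stronglyMeasurable u).measurable
  have hu2 := hL2 (Lp.memLp u)
  have hgrad : nonlocalGrad u₂ =ᵐ[ν₂.compProd m₂] nonlocalGrad u := nonlocalGrad_congr k₁ k₂ hu₂
  have hup : Integrable (fun z => |nonlocalGrad u z| ^ p) (ν₂.compProd m₂) :=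
    (memLp_ofReal_iff_integrable_abs_rpow hp0
      (measurable_nonlocalGrad hum).aestronglyMeasurable).1 (h2.ae_eq hgrad)
  have hvD : v₂ =ᵐ[ν₂] pLap p m₂ u := by
    refine h3.trans (EventuallyEq.trans ?_ (pLap_congr hrev₂.invariant hu₂))
    exact Eventually.of_forall fun x => nonlocalDiv_pFlux p m₂ u₂ x
  have hD : MemLp (pLap p m₂ u) 2 ν₂ := (Lp.memLp v₂).ae_eq hvD
  have h1' : (u, -v₁) ∈ subdifferential (fun u : Lp ℝ 2 ν₁ => (totalVariation m₁ ν₁ u : EReal)) :=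
    h1
  rw [mem_subdifferential_totalVariation_iff hinv₁] at h1'
  rw [mem_subdifferential_onePEnergy_iff hinv₁ hrev₂.invariant hac hp]
  refine ⟨⟨h1'.1, hup⟩, fun w hw i1 i2 => ?_⟩
  have key1 := h1'.2 w hw i1
  have hh : MemLp (fun x => w x - u x) 2 ν₁ := hw.sub (Lp.memLp u)
  have hgu := (measurable_nonlocalGrad hum).aestronglyMeasurable (μ := ν₂.compProd m₂)
  have hgw := aestronglyMeasurable_nonlocalGrad k₁ k₂ (hL2 hw).1
  have hgh : ∀ z, nonlocalGrad (fun x => w x - u x) z = nonlocalGrad w z - nonlocalGrad u z :=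
    fun z => by simp only [nonlocalGrad]; ring
  have hhp : Integrable (fun z => |nonlocalGrad (fun x => w x - u x) z| ^ p)
      (ν₂.compProd m₂) := by
    refine (integrable_abs_add_rpow hp hgw hgu i2 hup (-1)).congr
      (Eventually.of_forall fun z => ?_)
    simp only [hgh]
    congr 2; ring
  have hflux : Integrable (fun z => pFlux p (nonlocalGrad u z) *
      nonlocalGrad (fun x => w x - u x) z) (ν₂.compProd m₂) := by
    simpa using integrable_pFlux_add_mul hp hgu
      (aestronglyMeasurable_nonlocalGrad k₁ k₂ (hL2 hh).1) hup hhp le_rfl zero_le_one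
  have key2 : ∫ z, |nonlocalGrad u z| ^ p ∂(ν₂.compProd m₂) + p * ∫ z, pFlux p (nonlocalGrad u z) *
      nonlocalGrad (fun x => w x - u x) z ∂(ν₂.compProd m₂) ≤
      ∫ z, |nonlocalGrad w z| ^ p ∂(ν₂.compProd m₂) := by
    rw [← integral_const_mul, ← integral_add hup (hflux.const_mul p)]
    refine integral_mono (hup.add (hflux.const_mul p)) i2 fun z => ?_
    have := abs_rpow_add_pFlux_le hp (nonlocalGrad u z) (nonlocalGrad w z)
    simp only [hgh]
    linarith
  have key3 := integral_pFlux_mul_nonlocalGrad_of_memLp hrev₂ hp hcase hum hu2 hup hD (hL2 hh) hflux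
  have key4 : ∫ x, v x * (w x - u x) ∂ν₁ = ∫ x, (-v₁ : Lp ℝ 2 ν₁) x * (w x - u x) ∂ν₁ -
      ∫ x, pLap p m₂ u x * (w x - u x) ∂ν₂ := by
    have i3 : Integrable (fun x => v₂ x * (w x - u x)) ν₂ := (Lp.memLp v₂).integrable_mul (hL2 hh)
    have e : ∫ x, pLap p m₂ u x * (w x - u x) ∂ν₂ =
        ∫ x, density ν₁ ν₂ x * (v₂ x * (w x - u x)) ∂ν₁ := by
      rw [integral_density_mul hac]
      refine integral_congr_ae ?_
      filter_upwards [hvD] with x hx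
      rw [hx]
    have i4 : Integrable (fun x => (-v₁ : Lp ℝ 2 ν₁) x * (w x - u x)) ν₁ :=
      (Lp.memLp (-v₁)).integrable_mul hh
    rw [e, ← integral_sub i4 ((integrable_density_mul hac).2 i3)]
    refine integral_congr_ae ?_
    filter_upwards [hv, Lp.coeFn_neg v₁] with x hx1 hx2
    rw [hx1, hx2, Pi.neg_apply]
    ring
  rw [key4]
  have e5 : 1 / (2 * p) * ∫ z, |nonlocalGrad w z| ^ p ∂(ν₂.compProd m₂) ≥
      1 / (2 * p) * ∫ z, |nonlocalGrad u z| ^ p ∂(ν₂.compProd m₂) -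
        ∫ x, pLap p m₂ u x * (w x - u x) ∂ν₂ := by
    have hcp : (0 : ℝ) ≤ 1 / (2 * p) := by positivity
    have := mul_le_mul_of_nonneg_left key2 hcp
    rw [mul_add] at this
    have e6 : 1 / (2 * p) * (p * ∫ z, pFlux p (nonlocalGrad u z) *
      nonlocalGrad (fun x => w x - u x) z ∂(ν₂.compProd m₂)) = 1 / 2 *
        ∫ z, pFlux p (nonlocalGrad u z) *
          nonlocalGrad (fun x => w x - u x) z ∂(ν₂.compProd m₂) := by
      field_simp
    rw [e6, key3] at this
    linarith
  linarith

end Operators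

lemma mem_onePLaplacian_of_eq {m₁ m₂ : Kernel X X} [IsMarkovKernel m₂] {ν₁ ν₂ : Measure X}
    [SigmaFinite ν₂] {p : ℝ} (hrev₂ : Kernel.IsReversible m₂ ν₂) (hp : 1 < p)
    {u V v : Lp ℝ 2 ν₁}
    (hV : (u, V) ∈ subdifferential (fun u : Lp ℝ 2 ν₁ => (totalVariation m₁ ν₁ u : EReal)))
    (hu2 : MemLp u 2 ν₂) (hup : Integrable (fun z => |nonlocalGrad u z| ^ p) (ν₂.compProd m₂))
    (hD : MemLp (pLap p m₂ u) 2 ν₂)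
    (hv : v =ᵐ[ν₁] fun x => V x - density ν₁ ν₂ x * pLap p m₂ u x) (hac' : ν₁ ≪ ν₂) :
    (u, v) ∈ onePLaplacian p m₁ m₂ ν₁ ν₂ := by
  have k₁ := measurePreserving_fst_compProd m₂ ν₂
  have k₂ := measurePreserving_snd_compProd hrev₂.invariant
  have hu₂ := hu2.coeFn_toLp
  have hum : Measurable u := (Lp.stronglyMeasurable u).measurable
  refine ⟨-V, hu2.toLp u, hD.toLp _, ?_, ⟨?_, ?_⟩, hu₂, ?_⟩
  · have : (u, - -V) ∈
        subdifferential (fun u : Lp ℝ 2 ν₁ => (totalVariation m₁ ν₁ u : EReal)) := by rwa [neg_neg]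
    exact this
  · exact ((memLp_ofReal_iff_integrable_abs_rpow (by linarith)
      (measurable_nonlocalGrad hum).aestronglyMeasurable).2 hup).ae_eq
      (nonlocalGrad_congr k₁ k₂ hu₂).symm
  · refine hD.coeFn_toLp.trans ((pLap_congr hrev₂.invariant hu₂).symm.trans ?_)
    exact Eventually.of_forall fun x => (nonlocalDiv_pFlux p m₂ _ x).symm
  · filter_upwards [hv, Lp.coeFn_neg V, hac'.ae_eq hD.coeFn_toLp] with x h1 h2 h3
    change v x = _
    rw [h1, h2, h3, Pi.neg_apply, neg_neg]

/-! ### The subdifferential of the total variation, tested with bounded integrable functions -/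

lemma memLp_two_of_integrable_of_bounded {ν : Measure X} {w : X → ℝ} (hw : Integrable w ν) {M : ℝ}
    (hM : ∀ x, |w x| ≤ M) : MemLp w 2 ν := by
  rw [memLp_two_iff_integrable_sq hw.1]
  refine (hw.abs.const_mul M).mono' (hw.1.pow 2) (Eventually.of_forall fun x => ?_)
  rw [Real.norm_of_nonneg (sq_nonneg _), ← sq_abs, sq]
  exact mul_le_mul_of_nonneg_right (hM x) (abs_nonneg _)

/-- A function whose pairing with `L¹` functions is bounded by their norm is bounded by `1`. -/
lemma ae_abs_le_one_of_integral_mul_le {ν : Measure X} [SigmaFinite ν] {V : X → ℝ}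
    (h : ∀ w : X → ℝ, Integrable w ν → (∀ x, |w x| ≤ 1) →
      Integrable (fun x => V x * w x) ν ∧ ∫ x, V x * w x ∂ν ≤ ∫ x, |w x| ∂ν) :
    ∀ᵐ x ∂ν, |V x| ≤ 1 := by
  have hset : ∀ e : ℝ, |e| = 1 → ∀ s, MeasurableSet s → ν s < ∞ →
      IntegrableOn (fun x => V x * e) s ν ∧ ∫ x in s, V x * e ∂ν ≤ ∫ x in s, (1 : ℝ) ∂ν := by
    intro e he s hs hνs
    have hi : Integrable (s.indicator fun _ => e) ν :=
      (integrable_indicator_iff hs).2 (integrableOn_const hνs.ne)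
    obtain ⟨h1, h2⟩ := h _ hi fun x => by
      by_cases hx : x ∈ s
      · rw [Set.indicator_of_mem hx, he]
      · rw [Set.indicator_of_notMem hx, abs_zero]; exact zero_le_one
    have e1 : (fun x => V x * s.indicator (fun _ => e) x) = s.indicator fun x => V x * e := by
      ext x
      by_cases hx : x ∈ s <;> simp [hx]
    have e2 : (fun x => |s.indicator (fun _ => e) x|) = s.indicator fun _ => (1 : ℝ) := by
      ext x
      by_cases hx : x ∈ s <;> simp [hx, he]
    rw [e1, integrable_indicator_iff hs] at h1
    rw [e1, e2, integral_indicator hs, integral_indicator hs] at h2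
    exact ⟨h1, h2⟩
  have hsign : ∀ e : ℝ, |e| = 1 → ∀ᵐ x ∂ν, 0 ≤ 1 - V x * e := by
    intro e he
    refine ae_nonneg_of_forall_setIntegral_nonneg_of_sigmaFinite (fun s hs hνs => ?_)
      fun s hs hνs => ?_
    · exact (integrableOn_const hνs.ne).sub (hset e he s hs hνs).1
    · have h1 : Integrable (fun _ : X => (1 : ℝ)) (ν.restrict s) := integrableOn_const hνs.ne
      rw [integral_sub h1 (hset e he s hs hνs).1]
      linarith [(hset e he s hs hνs).2]
  filter_upwards [hsign 1 (by simp), hsign (-1) (by simp)] with x h1 h2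
  rw [abs_le]
  constructor <;> linarith

/-- For `V ∈ L²`, the subgradient inequality of the total variation has to be tested with bounded
integrable perturbations only. -/
lemma subgradient_totalVariation_of_bounded {m : Kernel X X} [IsMarkovKernel m] {ν : Measure X}
    [SFinite ν] (hinv : Kernel.Invariant m ν) {u V : X → ℝ} (hu : MemLp u 2 ν) (hV : MemLp V 2 ν)
    (hui : Integrable (fun z => |nonlocalGrad u z|) (ν.compProd m))
    (h : ∀ w : X → ℝ, Integrable w ν → (∃ M : ℝ, ∀ x, |w x| ≤ M) →
      ∫ x, V x * w x ∂ν ≤ 1 / 2 * (∫ z, |nonlocalGrad u z + nonlocalGrad w z| ∂(ν.compProd m) -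
        ∫ z, |nonlocalGrad u z| ∂(ν.compProd m)))
    {w : X → ℝ} (hw : MemLp w 2 ν)
    (hwi : Integrable (fun z => |nonlocalGrad w z|) (ν.compProd m)) :
    1 / 2 * ∫ z, |nonlocalGrad u z| ∂(ν.compProd m) + ∫ x, V x * (w x - u x) ∂ν ≤
      1 / 2 * ∫ z, |nonlocalGrad w z| ∂(ν.compProd m) := by
  have h₁ := measurePreserving_fst_compProd m ν
  have h₂ := measurePreserving_snd_compProd hinv
  have hh : MemLp (fun x => w x - u x) 2 ν := hw.sub hu
  have hgu := aestronglyMeasurable_nonlocalGrad h₁ h₂ hu.1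
  have hgh : ∀ z, nonlocalGrad (fun x => w x - u x) z = nonlocalGrad w z - nonlocalGrad u z :=
    fun z => by simp only [nonlocalGrad]; ring
  have hlim1 := tendsto_integral_mul_truncation hV hh
  have hlim2 : Tendsto (fun n => ∫ z, |nonlocalGrad u z +
      nonlocalGrad (fun x => truncation n (w x - u x)) z| ∂(ν.compProd m)) atTop
      (𝓝 (∫ z, |nonlocalGrad w z| ∂(ν.compProd m))) := by
    refine tendsto_integral_of_dominated_convergence
      (fun z => 2 * |nonlocalGrad u z| + |nonlocalGrad w z|) (fun n => ?_)
      ((hui.const_mul 2).add hwi) (fun n => Eventually.of_forall fun z => ?_)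
      (Eventually.of_forall fun z => ?_)
    · exact continuous_abs.comp_aestronglyMeasurable
        (hgu.add (aestronglyMeasurable_nonlocalGrad h₁ h₂ (memLp_truncation hh n).1))
    · rw [Real.norm_eq_abs, abs_abs]
      have k1 := abs_nonlocalGrad_truncation_le n (fun x => w x - u x) z
      rw [hgh] at k1
      have k2 := abs_sub (nonlocalGrad w z) (nonlocalGrad u z)
      have k3 := abs_add_le (nonlocalGrad u z)
        (nonlocalGrad (fun x => truncation n (w x - u x)) z)
      linarith
    · have k := (tendsto_nonlocalGrad_truncation (fun x => w x - u x) z).const_add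
        (nonlocalGrad u z)
      rw [hgh, add_sub_cancel] at k
      exact k.abs
  have hle := le_of_tendsto_of_tendsto' hlim1
    ((hlim2.sub_const (∫ z, |nonlocalGrad u z| ∂(ν.compProd m))).const_mul (1 / 2)) fun n =>
      h _ (integrable_truncation hh n) ⟨_, fun x => abs_truncation_le_const n _⟩
  linarith

section Operators

variable {m₁ m₂ : Kernel X X} [IsMarkovKernel m₁] [IsMarkovKernel m₂] {ν₁ ν₂ : Measure X}
  [SigmaFinite ν₁] [SigmaFinite ν₂] {p : ℝ}

/-! ### The subdifferential of the sum is contained in the sum of the operators -/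

/-- The first variation of the subgradient inequality at `u` in the direction of a bounded
integrable `w`: the `p`-energy is differentiated, the total variation is kept. -/
lemma first_variation (hinv₁ : Kernel.Invariant m₁ ν₁)
    (hrev₂ : Kernel.IsReversible m₂ ν₂) (hac : ν₂ ≪ ν₁)
    {C : ℝ} (hle : ν₂ ≤ ENNReal.ofReal C • ν₁) (hp : 1 < p) (hcase : ν₂ Set.univ < ∞ ∨ 2 ≤ p)
    {u v : Lp ℝ 2 ν₁} (h : (u, v) ∈ subdifferential (onePEnergy p m₁ m₂ ν₁ ν₂)) {w : X → ℝ}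
    (hw : Integrable w ν₁) {M : ℝ} (hM : ∀ x, |w x| ≤ M) :
    Integrable (fun x => (v x + density ν₁ ν₂ x * pLap p m₂ u x) * w x) ν₁ ∧
    ∫ x, (v x + density ν₁ ν₂ x * pLap p m₂ u x) * w x ∂ν₁ ≤
      1 / 2 * (∫ z, |nonlocalGrad u z + nonlocalGrad w z| ∂(ν₁.compProd m₁) -
        ∫ z, |nonlocalGrad u z| ∂(ν₁.compProd m₁)) := by
  have h₁ := measurePreserving_fst_compProd m₁ ν₁
  have h₂ := measurePreserving_snd_compProd hinv₁
  have k₁ := measurePreserving_fst_compProd m₂ ν₂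
  have k₂ := measurePreserving_snd_compProd hrev₂.invariant
  rw [mem_subdifferential_onePEnergy_iff hinv₁ hrev₂.invariant hac hp] at h
  obtain ⟨⟨hui, hup⟩, h⟩ := h
  have hum : Measurable u := (Lp.stronglyMeasurable u).measurable
  have hu2 : MemLp u 2 ν₂ := (Lp.memLp u).of_measure_le_smul ENNReal.ofReal_ne_top hle
  have hwL := memLp_two_of_integrable_of_bounded hw hM
  have hw₂ : Integrable w ν₂ := hw.of_measure_le_smul ENNReal.ofReal_ne_top hle
  have hwL₂ := memLp_two_of_integrable_of_bounded hw₂ hM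
  have hgw₂ : Integrable (nonlocalGrad w) (ν₂.compProd m₂) :=
    memLp_one_iff_integrable.1 (memLp_nonlocalGrad k₁ k₂ (memLp_one_iff_integrable.2 hw₂))
  have hgw₁ : Integrable (nonlocalGrad w) (ν₁.compProd m₁) :=
    memLp_one_iff_integrable.1 (memLp_nonlocalGrad h₁ h₂ (memLp_one_iff_integrable.2 hw))
  have hgu₁ := (measurable_nonlocalGrad hum).aestronglyMeasurable (μ := ν₁.compProd m₁)
  have hgu₂ := (measurable_nonlocalGrad hum).aestronglyMeasurable (μ := ν₂.compProd m₂)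
  have hui' : Integrable (nonlocalGrad u) (ν₁.compProd m₁) := (integrable_norm_iff hgu₁).1 hui
  have hwp : Integrable (fun z => |nonlocalGrad w z| ^ p) (ν₂.compProd m₂) := by
    refine integrable_abs_rpow_of_bounded hp hgw₂ (M := M + M) (Eventually.of_forall fun z => ?_)
    exact (abs_sub _ _).trans (add_le_add (hM _) (hM _))
  have hibp := integral_pFlux_mul_nonlocalGrad hrev₂ hp hcase hum hu2 hup hwL₂
    (Eventually.of_forall hM)
  have hvw : Integrable (fun x => v x * w x) ν₁ := (Lp.memLp v).integrable_mul hwL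
  have hDw := (integrable_density_mul hac).2 hibp.1
  have hsplit : ∀ x, (v x + density ν₁ ν₂ x * pLap p m₂ u x) * w x =
      v x * w x + density ν₁ ν₂ x * (pLap p m₂ u x * w x) := fun x => by ring
  simp only [hsplit]
  refine ⟨hvw.add hDw, ?_⟩
  rw [integral_add hvw hDw, integral_density_mul hac]
  have hlim := ((tendsto_integral_pFlux_add_mul hp hgu₂ hgw₂.1 hup hwp).const_mul
    (1 / 2)).const_add (1 / 2 * (∫ z, |nonlocalGrad u z + nonlocalGrad w z| ∂(ν₁.compProd m₁) -
        ∫ z, |nonlocalGrad u z| ∂(ν₁.compProd m₁)))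
  rw [hibp.2] at hlim
  have hmain : ∫ x, v x * w x ∂ν₁ ≤
      1 / 2 * (∫ z, |nonlocalGrad u z + nonlocalGrad w z| ∂(ν₁.compProd m₁) -
        ∫ z, |nonlocalGrad u z| ∂(ν₁.compProd m₁)) + -∫ x, pLap p m₂ u x * w x ∂ν₂ := by
    refine ge_of_tendsto' hlim fun n => ?_
    obtain ⟨t, ht⟩ : ∃ t : ℝ, t = 1 / ((n : ℝ) + 1) := ⟨_, rfl⟩
    have ht0 : 0 < t := by rw [ht]; positivity
    have ht1 : t ≤ 1 := by
      rw [ht]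
      exact div_le_one_of_le₀ (by linarith [Nat.cast_nonneg (α := ℝ) n]) (by positivity)
    rw [← ht]
    have hgrad : ∀ z, nonlocalGrad (fun x => u x + t * w x) z =
        nonlocalGrad u z + t * nonlocalGrad w z := fun z => by simp only [nonlocalGrad]; ring
    have j1 : Integrable (fun z => |nonlocalGrad u z + t * nonlocalGrad w z|) (ν₁.compProd m₁) :=
      (hui'.add (hgw₁.const_mul t)).abs
    have j2 : Integrable (fun z => |nonlocalGrad u z + nonlocalGrad w z|) (ν₁.compProd m₁) :=
      (hui'.add hgw₁).abs
    have j3 := integrable_abs_add_rpow hp hgu₂ hgw₂.1 hup hwp t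
    have key := h (fun x => u x + t * w x) ((Lp.memLp u).add (hwL.const_mul t))
      (by simpa only [hgrad] using j1) (by simpa only [hgrad] using j3)
    simp only [hgrad, add_sub_cancel_left] at key
    have e1 : ∫ x, v x * (t * w x) ∂ν₁ = t * ∫ x, v x * w x ∂ν₁ := by
      rw [← integral_const_mul]
      congr 1; ext x; ring
    rw [e1] at key
    have hconv : ∫ z, |nonlocalGrad u z + t * nonlocalGrad w z| ∂(ν₁.compProd m₁) ≤
        (1 - t) * ∫ z, |nonlocalGrad u z| ∂(ν₁.compProd m₁) +
          t * ∫ z, |nonlocalGrad u z + nonlocalGrad w z| ∂(ν₁.compProd m₁) := by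
      rw [← integral_const_mul, ← integral_const_mul,
        ← integral_add (hui.const_mul _) (j2.const_mul _)]
      refine integral_mono j1 ((hui.const_mul _).add (j2.const_mul _)) fun z => ?_
      have e : nonlocalGrad u z + t * nonlocalGrad w z =
          (1 - t) * nonlocalGrad u z + t * (nonlocalGrad u z + nonlocalGrad w z) := by ring
      dsimp only
      rw [e]
      refine (abs_add_le _ _).trans (le_of_eq ?_)
      rw [abs_mul, abs_mul, abs_of_nonneg ht0.le, abs_of_nonneg (by linarith : 0 ≤ 1 - t)]
    have hpow := integral_abs_rpow_add_le hp hgu₂ hgw₂.1 hup hwp ht0.le ht1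
    have hcp : (0 : ℝ) ≤ 1 / (2 * p) := by positivity
    have hpow' := mul_le_mul_of_nonneg_left hpow hcp
    rw [mul_add] at hpow'
    have e2 : 1 / (2 * p) * (p * t * ∫ z, pFlux p (nonlocalGrad u z + t * nonlocalGrad w z) *
        nonlocalGrad w z ∂(ν₂.compProd m₂)) = t * (1 / 2 * ∫ z, pFlux p (nonlocalGrad u z +
          t * nonlocalGrad w z) * nonlocalGrad w z ∂(ν₂.compProd m₂)) := by
      field_simp
    rw [e2] at hpow'
    refine le_of_mul_le_mul_left ?_ ht0
    linarith
  linarith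

theorem subdifferential_subset_onePLaplacian (hinv₁ : Kernel.Invariant m₁ ν₁)
    (hrev₂ : Kernel.IsReversible m₂ ν₂) (hac : ν₂ ≪ ν₁)
    (hbdd : MemLp (density ν₁ ν₂) ∞ ν₁)
    {c : ℝ} (hc0 : 0 < c) (hc : ∀ᵐ x ∂ν₁, c ≤ density ν₁ ν₂ x)
    (hp : 1 < p) (hcase : ν₂ Set.univ < ∞ ∨ 2 ≤ p) :
    subdifferential (onePEnergy p m₁ m₂ ν₁ ν₂) ⊆ onePLaplacian p m₁ m₂ ν₁ ν₂ := by
  rintro ⟨u, v⟩ huv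
  have h₁ := measurePreserving_fst_compProd m₁ ν₁
  have h₂ := measurePreserving_snd_compProd hinv₁
  obtain ⟨C, hC0, hC⟩ := exists_density_le hbdd
  have hle := le_smul_of_density_le hac hC
  have hle' := le_smul_of_le_density hac hc0 hc
  have hcinv : (ENNReal.ofReal c)⁻¹ ≠ ∞ := ENNReal.inv_ne_top.2 (by simpa using hc0)
  have hac' : ν₁ ≪ ν₂ := Measure.absolutelyContinuous_of_le_smul hle'
  obtain ⟨⟨hui, hup⟩, -⟩ :=
    (mem_subdifferential_onePEnergy_iff hinv₁ hrev₂.invariant hac hp u v).1 huv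
  have hum : Measurable u := (Lp.stronglyMeasurable u).measurable
  have hu2 : MemLp u 2 ν₂ := (Lp.memLp u).of_measure_le_smul ENNReal.ofReal_ne_top hle
  have hvar := fun (w : X → ℝ) (hw : Integrable w ν₁) (M : ℝ) (hM : ∀ x, |w x| ≤ M) =>
    first_variation hinv₁ hrev₂ hac hle hp hcase huv hw hM
  have hDm : Measurable (pLap p m₂ u) := (stronglyMeasurable_pLap hum).measurable
  have hμm := measurable_density (ν₁ := ν₁) (ν₂ := ν₂)
  have hVm : Measurable fun x => v x + density ν₁ ν₂ x * pLap p m₂ u x :=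
    (Lp.stronglyMeasurable v).measurable.add (hμm.mul hDm)
  -- The total variation is subadditive and bounded by the `L¹` norm.
  have hV1 : ∀ᵐ x ∂ν₁, |v x + density ν₁ ν₂ x * pLap p m₂ u x| ≤ 1 := by
    refine ae_abs_le_one_of_integral_mul_le fun w hw hw1 => ?_
    obtain ⟨k1, k2⟩ := hvar w hw 1 hw1
    refine ⟨k1, k2.trans ?_⟩
    have hgu : Integrable (nonlocalGrad u) (ν₁.compProd m₁) :=
      (integrable_norm_iff (measurable_nonlocalGrad hum).aestronglyMeasurable).1 hui
    have hgw : Integrable (nonlocalGrad w) (ν₁.compProd m₁) :=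
      memLp_one_iff_integrable.1 (memLp_nonlocalGrad h₁ h₂ (memLp_one_iff_integrable.2 hw))
    have k3 : ∫ z, |nonlocalGrad u z + nonlocalGrad w z| ∂(ν₁.compProd m₁) ≤
        ∫ z, |nonlocalGrad u z| ∂(ν₁.compProd m₁) +
          ∫ z, |nonlocalGrad w z| ∂(ν₁.compProd m₁) := by
      rw [← integral_add hui hgw.abs]
      exact integral_mono (hgu.add hgw).abs (hui.add hgw.abs) fun z => abs_add_le _ _
    have k4 := integral_abs_nonlocalGrad_le h₁ h₂ hw
    linarith
  have hV : MemLp (fun x => v x + density ν₁ ν₂ x * pLap p m₂ u x) 2 ν₁ := by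
    obtain ⟨D₁, D₂, hD₁, hD₂, hD⟩ := exists_integral_pFlux_decomposition hrev₂ hp hcase hum hu2 hup
    have hD₂' : MemLp D₂ 2 ν₁ := hD₂.of_measure_le_smul hcinv hle'
    have hμD₂ : MemLp (fun x => density ν₁ ν₂ x * D₂ x) 2 ν₁ := by
      refine hD₂'.of_le_mul (c := C) (hμm.aestronglyMeasurable.mul hD₂'.1) ?_
      filter_upwards [hC, hc] with x hx hx'
      rw [norm_mul, Real.norm_of_nonneg (hc0.le.trans hx')]
      gcongr
    refine memLp_two_of_bounded_of_add hVm.aestronglyMeasurable hV1 ((Lp.memLp v).add hμD₂)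
      ((integrable_density_mul hac).2 hD₁) ?_
    filter_upwards [hac' hD] with x hx
    rw [hx, Pi.add_apply]
    ring
  -- `D = (V - v) / μ`, and `μ ≥ c`.
  have hDL : MemLp (pLap p m₂ u) 2 ν₂ := by
    refine MemLp.of_measure_le_smul ENNReal.ofReal_ne_top hle ?_
    refine (hV.sub (Lp.memLp v)).of_le_mul (c := c⁻¹) hDm.aestronglyMeasurable ?_
    filter_upwards [hc] with x hx
    simp only [Pi.sub_apply, add_sub_cancel_left]
    rw [norm_mul, Real.norm_of_nonneg (hc0.le.trans hx), inv_mul_eq_div, le_div_iff₀ hc0, mul_comm]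
    gcongr
  refine mem_onePLaplacian_of_eq hrev₂ hp (V := hV.toLp _) ?_ hu2 hup hDL ?_ hac'
  · rw [mem_subdifferential_totalVariation_iff hinv₁]
    refine ⟨hui, fun w hw hwi => ?_⟩
    have key := subgradient_totalVariation_of_bounded hinv₁ (Lp.memLp u) hV hui
      (fun w hw ⟨M, hM⟩ => (hvar w hw M hM).2) hw hwi
    refine le_trans (le_of_eq ?_) key
    congr 1
    refine integral_congr_ae ?_
    filter_upwards [hV.coeFn_toLp] with x hx
    rw [hx]
  · filter_upwards [hV.coeFn_toLp] with x hx
    rw [hx]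
    ring

/-! ### Density of the domain -/

/-- A bounded function that vanishes where `∇g` does is in every `L^q(π)` if `{g ≠ 0}` has finite
measure: it lives on the set of the `(x, y)` with `g x ≠ 0` or `g y ≠ 0`. -/
lemma memLp_of_eq_zero_of_nonlocalGrad_eq_zero {ν : Measure X} {π : Measure (X × X)}
    (h₁ : MeasurePreserving Prod.fst π ν) (h₂ : MeasurePreserving Prod.snd π ν) {g : X → ℝ}
    (hg : Measurable g) (hsupp : ν {x | g x ≠ 0} ≠ ∞) {G : X × X → ℝ} (hG : Measurable G) {K : ℝ}
    (hK : ∀ z, |G z| ≤ K) (hG0 : ∀ z, nonlocalGrad g z = 0 → G z = 0) (q : ℝ≥0∞) :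
    MemLp G q π := by
  have hs : MeasurableSet {x | g x ≠ 0} := hg (measurableSet_singleton 0).compl
  have hT : MeasurableSet ({z : X × X | g z.1 ≠ 0} ∪ {z : X × X | g z.2 ≠ 0}) :=
    (measurable_fst hs).union (measurable_snd hs)
  have hπ : π ({z : X × X | g z.1 ≠ 0} ∪ {z : X × X | g z.2 ≠ 0}) ≠ ∞ := by
    have e1 : π {z : X × X | g z.1 ≠ 0} = ν {x | g x ≠ 0} :=
      h₁.measure_preimage hs.nullMeasurableSet
    have e2 : π {z : X × X | g z.2 ≠ 0} = ν {x | g x ≠ 0} :=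
      h₂.measure_preimage hs.nullMeasurableSet
    refine ne_top_of_le_ne_top ?_ (measure_union_le _ _)
    rw [e1, e2]
    exact ENNReal.add_ne_top.2 ⟨hsupp, hsupp⟩
  refine (memLp_indicator_const q hT K (Or.inr hπ)).mono hG.aestronglyMeasurable
    (Eventually.of_forall fun z => ?_)
  by_cases hz : z ∈ {z : X × X | g z.1 ≠ 0} ∪ {z : X × X | g z.2 ≠ 0}
  · rw [Set.indicator_of_mem hz, Real.norm_eq_abs, Real.norm_eq_abs]
    exact (hK z).trans (le_abs_self K)
  · have h0 : nonlocalGrad g z = 0 := by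
      simp only [Set.mem_union, Set.mem_ofPred_eq, not_or, not_not] at hz
      simp [nonlocalGrad, hz.1, hz.2]
    rw [hG0 z h0, norm_zero]
    positivity

/-- The functional `h ↦ ½ ∫ z ∇h dπ` on `L²` is represented by a function, for `z ∈ L²`: the
adjoint of the bounded operator `∇ : L²(ν) → L²(π)` is applied to `z / 2`. -/
lemma exists_integral_mul_eq_integral_nonlocalGrad {ν : Measure X} {π : Measure (X × X)}
    (h₁ : MeasurePreserving Prod.fst π ν) (h₂ : MeasurePreserving Prod.snd π ν) {z : X × X → ℝ}
    (hz : MemLp z 2 π) :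
    ∃ V : Lp ℝ 2 ν, ∀ h : X → ℝ, MemLp h 2 ν →
      ∫ x, V x * h x ∂ν = 1 / 2 * ∫ y, z y * nonlocalGrad h y ∂π := by
  let T : Lp ℝ 2 ν →L[ℝ] Lp ℝ 2 π :=
    (Lp.compMeasurePreservingₗᵢ ℝ Prod.snd h₂).toContinuousLinearMap -
      (Lp.compMeasurePreservingₗᵢ ℝ Prod.fst h₁).toContinuousLinearMap
  refine ⟨T.adjoint ((1 / 2 : ℝ) • hz.toLp z), fun h hh => ?_⟩
  have e := T.adjoint_inner_left (hh.toLp h) ((1 / 2 : ℝ) • hz.toLp z)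
  rw [inner_smul_left, L2.inner_def, L2.inner_def] at e
  have hT : T (hh.toLp h) =ᵐ[π] nonlocalGrad h := by
    have a1 := Lp.coeFn_sub (Lp.compMeasurePreserving Prod.snd h₂ (hh.toLp h))
      (Lp.compMeasurePreserving Prod.fst h₁ (hh.toLp h))
    have a2 := Lp.coeFn_compMeasurePreserving (hh.toLp h) h₂
    have a3 := Lp.coeFn_compMeasurePreserving (hh.toLp h) h₁
    filter_upwards [a1, a2, a3, h₂.quasiMeasurePreserving.ae_eq_comp hh.coeFn_toLp,
      h₁.quasiMeasurePreserving.ae_eq_comp hh.coeFn_toLp] with y b1 b2 b3 b4 b5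
    refine b1.trans ?_
    rw [Pi.sub_apply, b2, b3, b4, b5]
    rfl
  have e1 : ∫ x, (T.adjoint ((1 / 2 : ℝ) • hz.toLp z)) x * h x ∂ν =
      ∫ x, inner ℝ ((T.adjoint ((1 / 2 : ℝ) • hz.toLp z)) x) (hh.toLp h x) ∂ν := by
    refine integral_congr_ae ?_
    filter_upwards [hh.coeFn_toLp] with x hx
    rw [hx]
    simp [mul_comm]
  have e2 : ∫ y, inner ℝ (hz.toLp z y) (T (hh.toLp h) y) ∂π = ∫ y, z y * nonlocalGrad h y ∂π := by
    refine integral_congr_ae ?_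
    filter_upwards [hz.coeFn_toLp, hT] with y hy1 hy2
    rw [hy1, hy2]
    simp [mul_comm]
  rw [e1, e, e2]
  simp

/-- Bounded functions supported in a set of finite measure belong to the domain: the sign of `∇u`
gives a subgradient of the total variation. -/
lemma mem_operatorDomain_of_bounded (hinv₁ : Kernel.Invariant m₁ ν₁)
    (hrev₂ : Kernel.IsReversible m₂ ν₂)
    {C : ℝ} (hC : ∀ᵐ x ∂ν₁, density ν₁ ν₂ x ≤ C) (hle : ν₂ ≤ ENNReal.ofReal C • ν₁)
    {c : ℝ} (hc0 : 0 < c) (hc : ∀ᵐ x ∂ν₁, c ≤ density ν₁ ν₂ x)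
    (hle' : ν₁ ≤ (ENNReal.ofReal c)⁻¹ • ν₂)
    (hp : 1 < p) {u : Lp ℝ 2 ν₁} {g : X → ℝ} (hg : Measurable g)
    (hug : u =ᵐ[ν₁] g) (hsupp : ν₁ {x | g x ≠ 0} ≠ ∞) {M : ℝ} (hM : ∀ x, |g x| ≤ M) :
    u ∈ operatorDomain (onePLaplacian p m₁ m₂ ν₁ ν₂) := by
  have h₁ := measurePreserving_fst_compProd m₁ ν₁
  have h₂ := measurePreserving_snd_compProd hinv₁
  have k₁ := measurePreserving_fst_compProd m₂ ν₂
  have k₂ := measurePreserving_snd_compProd hrev₂.invariant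
  have hcinv : (ENNReal.ofReal c)⁻¹ ≠ ∞ := ENNReal.inv_ne_top.2 (by simpa using hc0)
  have hac : ν₂ ≪ ν₁ := Measure.absolutelyContinuous_of_le_smul hle
  have hac' : ν₁ ≪ ν₂ := Measure.absolutelyContinuous_of_le_smul hle'
  have hsupp₂ : ν₂ {x | g x ≠ 0} ≠ ∞ := by
    refine ne_top_of_le_ne_top ?_ (hle _)
    rw [Measure.smul_apply, smul_eq_mul]
    exact ENNReal.mul_ne_top ENNReal.ofReal_ne_top hsupp
  have hu2 : MemLp u 2 ν₂ := (Lp.memLp u).of_measure_le_smul ENNReal.ofReal_ne_top hle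
  have hgm := measurable_nonlocalGrad hg
  have hgM : ∀ z, |nonlocalGrad g z| ≤ M + M := fun z =>
    (abs_sub _ _).trans (add_le_add (hM _) (hM _))
  have hgrad₁ := nonlocalGrad_congr h₁ h₂ hug
  have hgrad₂ := nonlocalGrad_congr k₁ k₂ (hac.ae_eq hug)
  have hgi : Integrable (fun z => |nonlocalGrad g z|) (ν₁.compProd m₁) :=
    (memLp_one_iff_integrable.1 (memLp_of_eq_zero_of_nonlocalGrad_eq_zero h₁ h₂ hg hsupp hgm hgM
      (fun _ h => h) 1)).abs
  have hui : Integrable (fun z => |nonlocalGrad u z|) (ν₁.compProd m₁) :=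
    hgi.congr (hgrad₁.mono fun z hz => by simp only [hz])
  have hup : Integrable (fun z => |nonlocalGrad u z| ^ p) (ν₂.compProd m₂) :=
    ((memLp_ofReal_iff_integrable_abs_rpow (by linarith) hgm.aestronglyMeasurable).1
      (memLp_of_eq_zero_of_nonlocalGrad_eq_zero k₁ k₂ hg hsupp₂ hgm hgM (fun _ h => h) _)).congr
      (hgrad₂.mono fun z hz => by simp only [hz])
  have hD : MemLp (pLap p m₂ u) 2 ν₂ := by
    refine (memLp_two_integral_kernel ((measurable_pFlux p).comp hgm)
      (memLp_of_eq_zero_of_nonlocalGrad_eq_zero k₁ k₂ hg hsupp₂ ((measurable_pFlux p).comp hgm)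
        (K := (M + M) ^ (p - 1)) (fun z => ?_) (fun z hz => ?_) 2)).ae_eq
      (pLap_congr hrev₂.invariant (hac.ae_eq hug)).symm
    · rw [Function.comp_apply, abs_pFlux hp]
      exact Real.rpow_le_rpow (abs_nonneg _) (hgM z) (by linarith)
    · simp [hz, pFlux]
  -- `r / |r|` is the sign of `r`, with the value `0` at `r = 0`.
  have hσ : MemLp (fun z => nonlocalGrad g z / |nonlocalGrad g z|) 2 (ν₁.compProd m₁) := by
    refine memLp_of_eq_zero_of_nonlocalGrad_eq_zero h₁ h₂ hg hsupp (by fun_prop) (K := 1)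
      (fun z => ?_) (fun z hz => by simp [hz]) 2
    rw [abs_div, abs_abs]
    exact div_self_le_one _
  obtain ⟨V, hV⟩ := exists_integral_mul_eq_integral_nonlocalGrad h₁ h₂ hσ
  have hμD : MemLp (fun x => density ν₁ ν₂ x * pLap p m₂ u x) 2 ν₁ := by
    have hD' := hD.of_measure_le_smul hcinv hle'
    refine hD'.of_le_mul (c := C)
      ((measurable_density (ν₁ := ν₁) (ν₂ := ν₂)).aestronglyMeasurable.mul hD'.1) ?_
    filter_upwards [hC, hc] with x hx hx'
    rw [norm_mul, Real.norm_of_nonneg (hc0.le.trans hx')]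
    gcongr
  refine ⟨((Lp.memLp V).sub hμD).toLp _, mem_onePLaplacian_of_eq hrev₂ hp (V := V) ?_ hu2 hup hD
    (((Lp.memLp V).sub hμD).coeFn_toLp) hac'⟩
  rw [mem_subdifferential_totalVariation_iff hinv₁]
  refine ⟨hui, fun w hw hwi => ?_⟩
  have hh : MemLp (fun x => w x - u x) 2 ν₁ := hw.sub (Lp.memLp u)
  have hi : Integrable (fun z => nonlocalGrad g z / |nonlocalGrad g z| *
      nonlocalGrad (fun x => w x - u x) z) (ν₁.compProd m₁) :=
    hσ.integrable_mul (memLp_nonlocalGrad h₁ h₂ hh)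
  rw [hV _ hh, ← mul_add, ← integral_add hui hi]
  refine mul_le_mul_of_nonneg_left (integral_mono_ae (hui.add hi) hwi ?_) (by norm_num)
  filter_upwards [hgrad₁] with z hz
  have e : nonlocalGrad (fun x => w x - u x) z = nonlocalGrad w z - nonlocalGrad g z := by
    rw [← hz]
    simp only [nonlocalGrad]; ring
  rw [hz, e]
  generalize nonlocalGrad g z = a
  generalize nonlocalGrad w z = b
  rcases eq_or_ne a 0 with rfl | ha
  · simp
  · have ha' : 0 < |a| := abs_pos.2 ha
    have e1 : a / |a| * a = |a| := by
      rw [div_mul_eq_mul_div, ← abs_mul_abs_self a, mul_div_cancel_right₀ _ ha'.ne']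
    have e2 : a / |a| * b ≤ |b| := by
      refine (le_abs_self _).trans ?_
      rw [abs_mul, abs_div, abs_abs, div_self ha'.ne', one_mul]
    rw [mul_sub, e1]
    linarith

theorem dense_operatorDomain_onePLaplacian (hinv₁ : Kernel.Invariant m₁ ν₁)
    (hrev₂ : Kernel.IsReversible m₂ ν₂) (hac : ν₂ ≪ ν₁)
    (hbdd : MemLp (density ν₁ ν₂) ∞ ν₁)
    {c : ℝ} (hc0 : 0 < c) (hc : ∀ᵐ x ∂ν₁, c ≤ density ν₁ ν₂ x) (hp : 1 < p) :
    Dense (operatorDomain (onePLaplacian p m₁ m₂ ν₁ ν₂)) := by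
  obtain ⟨C, -, hC⟩ := exists_density_le hbdd
  refine (Lp.simpleFunc.dense (E := ℝ) (μ := ν₁) (p := 2) (by norm_num)).mono fun u hu => ?_
  obtain ⟨f, rfl⟩ : ∃ f : Lp.simpleFunc ℝ 2 ν₁, (f : Lp ℝ 2 ν₁) = u := ⟨⟨u, hu⟩, rfl⟩
  obtain ⟨M, hM⟩ := (Lp.simpleFunc.toSimpleFunc f).exists_forall_norm_le
  refine mem_operatorDomain_of_bounded hinv₁ hrev₂ hC (le_smul_of_density_le hac hC) hc0 hc
    (le_smul_of_le_density hac hc0 hc) hp (Lp.simpleFunc.toSimpleFunc f).measurable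
    (Lp.simpleFunc.toSimpleFunc_eq_toFun f).symm ?_ hM
  exact (SimpleFunc.measure_support_lt_top_of_memLp _ (Lp.simpleFunc.memLp f) (by norm_num)
    (by norm_num)).ne

end Operators

end RandomWalk

theorem theorem3p1 {X : Type*} [MeasurableSpace X] [MeasurableSpace.CountablyGenerated X]
    (m₁ m₂ : Kernel X X) [IsMarkovKernel m₁] [IsMarkovKernel m₂]
    (ν₁ ν₂ : Measure X) [SigmaFinite ν₁] [SigmaFinite ν₂]
    (hinv₁ : Kernel.Invariant m₁ ν₁) (hrev₂ : Kernel.IsReversible m₂ ν₂)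
    (hac : ν₂ ≪ ν₁)
    (hbdd : MemLp (RandomWalk.density ν₁ ν₂) ∞ ν₁)
    (hpos : ∃ c : ℝ, 0 < c ∧ ∀ᵐ x ∂ν₁, c ≤ RandomWalk.density ν₁ ν₂ x)
    (p : ℝ) (hp : 1 < p)
    (hcase : ν₁ Set.univ < ∞ ∨ (ν₁ Set.univ = ∞ ∧ 2 ≤ p)) :
    RandomWalk.subdifferential (RandomWalk.onePEnergy p m₁ m₂ ν₁ ν₂) =
        RandomWalk.onePLaplacian p m₁ m₂ ν₁ ν₂ ∧
      RandomWalk.IsCompletelyAccretive (RandomWalk.onePLaplacian p m₁ m₂ ν₁ ν₂) ∧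
      Dense (RandomWalk.operatorDomain (RandomWalk.onePLaplacian p m₁ m₂ ν₁ ν₂)) := by
  obtain ⟨c, hc0, hc⟩ := hpos
  have hcase₂ : ν₂ Set.univ < ∞ ∨ 2 ≤ p := by
    refine hcase.imp (fun h => ?_) And.right
    obtain ⟨C, -, hC⟩ := RandomWalk.exists_density_le hbdd
    refine (RandomWalk.le_smul_of_density_le hac hC Set.univ).trans_lt ?_
    rw [Measure.smul_apply, smul_eq_mul]
    exact ENNReal.mul_lt_top ENNReal.ofReal_lt_top h
  have heq : RandomWalk.subdifferential (RandomWalk.onePEnergy p m₁ m₂ ν₁ ν₂) =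
      RandomWalk.onePLaplacian p m₁ m₂ ν₁ ν₂ :=
    (RandomWalk.subdifferential_subset_onePLaplacian hinv₁ hrev₂ hac hbdd hc0 hc hp hcase₂).antisymm
      (RandomWalk.onePLaplacian_subset_subdifferential hinv₁ hrev₂ hac hbdd hp hcase₂)
  refine ⟨heq, ?_, RandomWalk.dense_operatorDomain_onePLaplacian hinv₁ hrev₂ hac hbdd hc0 hc hp⟩
  rw [← heq]
  exact RandomWalk.isCompletelyAccretive_subdifferential_onePEnergy hinv₁ hrev₂.invariant hac hp
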